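/- All manifolds are smooth, Hausdorff, second countable, without boundary and finite-dimensional. A locally conformal symplectic form on a manifold $M$ is a smooth nondegenerate $2$-form $\Omega$ such that every point of $M$ has an open neighbourhood $U$ and a smooth positive function $f$ on $U$ for which $f\,\Omega|_U$ is a symplectic form (nondegenerate and closed). A locally conformal symplectic manifold $(M,\Omega,\omega)$ is a manifold $M$ of dimension $2n>2$ with a locally conformal symplectic form $\Omega$ and its Lee form $\omega$, that is, the closed $1$-form with $d\Omega=\omega\wedge\Omega$. Let $(M,\Omega,\omega)$ be a locally conformal symplectic manifold, and let $\iota:Q\hookrightarrow M$ be the inclusion of a (possibly only immersed) submanifold. For $q\in Q$ put $(T_qQ)^\Omega=\{v\in T_qM:\Omega(v,w)=0\ \text{for all } w\in T_qQ\}$, and assume that $\dim\big((T_qQ)^\Omega\cap T_qQ\big)$ does not depend on $q\in Q$. Let $\mathcal F$ be the characteristic foliation of $Q$, whose leaves are the maximal connected integral manifolds of the distribution $TQ^\Omega\cap TQ$. Let $N=Q/\mathcal F$ be the space of leaves, obtained by identifying all points on a leaf, and let $\pi:Q\to N$ be the canonical projection, so that $\pi$ is onto and its fibres are exactly the leaves.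 Assume that $N$ is a manifold of dimension greater than $2$ and that $\pi$ is a (smooth) submersion. Then there exists a locally conformal symplectic form $\tau$ on $N$ with $\pi^*\tau=\iota^*\Omega$ if and only if $(\iota^*\omega)(X)=0$ for every smooth section $X$ of $TQ^\Omega\cap TQ$. -/

import Mathlib

open scoped Manifold ContDiff Topology

namespace LCSReduction

universe u

noncomputable section

section Forms

variable {E : Type*} [NormedAddCommGroup E] [NormedSpace ℝ E]
  {M : Type*} [TopologicalSpace M] [ChartedSpace E M]
  {E' : Type*} [NormedAddCommGroup E'] [NormedSpace ℝ E']
  {M' : Type*} [TopologicalSpace M'] [ChartedSpace E' M']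

/-- A (not necessarily smooth) differential `k`-form on a boundaryless manifold `M` modelled
on `E`. -/
abbrev DiffForm (E : Type*) [NormedAddCommGroup E] [NormedSpace ℝ E]
    (M : Type*) [TopologicalSpace M] [ChartedSpace E M] (k : ℕ) : Type _ :=
  ∀ x : M, TangentSpace 𝓘(ℝ, E) x [⋀^Fin k]→L[ℝ] ℝ

/-- The pullback of a form along a map: `(f^*θ)_x(v₁,…) = θ_{f x}(df v₁,…)`. -/
def pullback {k : ℕ} (f : M → M') (θ : DiffForm E' M' k) : DiffForm E M k :=
  fun x => (θ (f x)).compContinuousLinearMap (mfderiv 𝓘(ℝ, E) 𝓘(ℝ, E') f x)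

/-- The coordinate expression of a form in the chart around `x₀`, i.e. its pullback along the
inverse of the chart. Only its values on the chart's target are meaningful. -/
def inChart {k : ℕ} (θ : DiffForm E M k) (x₀ : M) : E → E [⋀^Fin k]→L[ℝ] ℝ :=
  fun y => (θ ((extChartAt 𝓘(ℝ, E) x₀).symm y)).compContinuousLinearMap
    (mfderiv 𝓘(ℝ, E) 𝓘(ℝ, E) (extChartAt 𝓘(ℝ, E) x₀).symm y)

/-- A form is smooth on `U` if all its coordinate expressions are. -/
def SmoothFormOn {k : ℕ} (θ : DiffForm E M k) (U : Set M) : Prop :=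
  ∀ x₀ : M, ContDiffOn ℝ ∞ (inChart θ x₀)
    ((extChartAt 𝓘(ℝ, E) x₀).target ∩ (extChartAt 𝓘(ℝ, E) x₀).symm ⁻¹' U)

/-- The exterior derivative: at `x`, differentiate the coordinate expression in the chart
around `x` and pull the result back along that chart. -/
def extD {k : ℕ} (θ : DiffForm E M k) : DiffForm E M (k + 1) :=
  fun x => (extDeriv (inChart θ x) (extChartAt 𝓘(ℝ, E) x x)).compContinuousLinearMap
    (mfderiv 𝓘(ℝ, E) 𝓘(ℝ, E) (extChartAt 𝓘(ℝ, E) x) x)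

/-- The wedge product of a covector with an alternating `k`-form, normalised by
`(α ∧ β)(v₀,…,v_k) = ∑ i, (-1)^i α(v_i) β(v₀,…,v̂_i,…,v_k)`. -/
def wedgeOne {V : Type*} [NormedAddCommGroup V] [NormedSpace ℝ V] {k : ℕ}
    (α : V [⋀^Fin 1]→L[ℝ] ℝ) (β : V [⋀^Fin k]→L[ℝ] ℝ) : V [⋀^Fin (k + 1)]→L[ℝ] ℝ :=
  ContinuousAlternatingMap.alternatizeUncurryFin
    (((ContinuousAlternatingMap.ofSubsingleton ℝ V ℝ (0 : Fin 1)).symm α).smulRight β)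

theorem wedgeOne_apply {V : Type*} [NormedAddCommGroup V] [NormedSpace ℝ V]
    (α : V [⋀^Fin 1]→L[ℝ] ℝ) (β : V [⋀^Fin 2]→L[ℝ] ℝ) (x y z : V) :
    wedgeOne α β ![x, y, z] =
      α ![x] * β ![y, z] + α ![y] * β ![z, x] + α ![z] * β ![x, y] := by
  have h : β ![x, z] = - β ![z, x] := by
    have h' := β.toAlternatingMap.map_swap ![z, x] (i := 0) (j := 1) (by decide)
    have hs : (![z, x] ∘ Equiv.swap (0 : Fin 2) 1) = ![x, z] := by
      ext i
      fin_cases i <;> simp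
    rw [hs] at h'
    exact h'
  have e0 : (0 : Fin 3).removeNth ![x, y, z] = ![y, z] := by
    ext i
    fin_cases i <;> rfl
  have e1 : (1 : Fin 3).removeNth ![x, y, z] = ![x, z] := by
    ext i
    fin_cases i <;> rfl
  have e2 : (2 : Fin 3).removeNth ![x, y, z] = ![x, y] := by
    ext i
    fin_cases i <;> rfl
  have e (v : V) : (fun _ : Fin 1 => v) = ![v] := by
    ext i
    fin_cases i
    rfl
  have hα (v : V) : (ContinuousAlternatingMap.ofSubsingleton ℝ V ℝ (0 : Fin 1)).symm α v
      = α ![v] := by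
    rw [← e]
    rfl
  rw [wedgeOne, ContinuousAlternatingMap.alternatizeUncurryFin_apply, Fin.sum_univ_three, e0, e1,
    e2]
  simp [hα, h]

/-- The product of a function and a form. -/
def smulForm {k : ℕ} (f : M → ℝ) (θ : DiffForm E M k) : DiffForm E M k :=
  fun x => f x • θ x

/-- Nondegeneracy of a 2-form at a point. -/
def NondegenerateAt (θ : DiffForm E M 2) (x : M) : Prop :=
  ∀ v : TangentSpace 𝓘(ℝ, E) x, (∀ w : TangentSpace 𝓘(ℝ, E) x, θ x ![v, w] = 0) → v = 0

/-- `θ` restricts to a symplectic form on the open set `U`. -/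
structure IsSymplecticOn (θ : DiffForm E M 2) (U : Set M) : Prop where
  smooth : SmoothFormOn θ U
  nondegenerate : ∀ x ∈ U, NondegenerateAt θ x
  closed : ∀ x ∈ U, extD θ x = 0

/-- Locally conformal symplectic forms. -/
structure IsLCSForm (Ω : DiffForm E M 2) : Prop where
  smooth : SmoothFormOn Ω Set.univ
  nondegenerate : ∀ x, NondegenerateAt Ω x
  locally_conformal : ∀ x : M, ∃ U : Set M, IsOpen U ∧ x ∈ U ∧ ∃ f : M → ℝ,
    ContMDiffOn 𝓘(ℝ, E) 𝓘(ℝ, ℝ) ∞ f U ∧ (∀ y ∈ U, 0 < f y) ∧ IsSymplecticOn (smulForm f Ω) U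

/-- `(M, Ω, η)` is a locally conformal symplectic manifold: `Ω` is a locally conformal symplectic
form and `η` is its Lee form, the closed 1-form with `dΩ = η ∧ Ω`. -/
structure IsLCSManifold (Ω : DiffForm E M 2) (η : DiffForm E M 1) : Prop where
  isLCSForm : IsLCSForm Ω
  lee_smooth : SmoothFormOn η Set.univ
  lee_closed : ∀ x, extD η x = 0
  lee_eq : ∀ x, extD Ω x = wedgeOne (V := E) (η x) (Ω x)

/-- The orthogonal complement of a subspace of a tangent space with respect to a 2-form. -/
def orthogonal (Ω : DiffForm E M 2) (x : M) (W : Submodule ℝ (TangentSpace 𝓘(ℝ, E) x)) :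
    Submodule ℝ (TangentSpace 𝓘(ℝ, E) x) where
  carrier := {v | ∀ w ∈ W, Ω x ![v, w] = 0}
  add_mem' := by
    intro a b ha hb w hw
    have h : Ω x ![a + b, w] = Ω x ![a, w] + Ω x ![b, w] :=
      (Ω x).toAlternatingMap.map_vecCons_add ![w] a b
    rw [h, ha w hw, hb w hw, add_zero]
  zero_mem' := by
    intro w _
    exact (Ω x).map_coord_zero 0 rfl
  smul_mem' := by
    intro c a ha w hw
    have h : Ω x ![c • a, w] = c • Ω x ![a, w] :=
      (Ω x).toAlternatingMap.map_vecCons_smul ![w] c a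
    rw [h, ha w hw, smul_zero]

end Forms

section Distributions

variable {E : Type*} [NormedAddCommGroup E] [NormedSpace ℝ E]
  {Q : Type u} [TopologicalSpace Q] [ChartedSpace E Q]

/-- `S` is a connected integral manifold of the distribution `D`: it is the image of an injective
immersion `j : L → Q` of a connected manifold `L` whose tangent spaces are carried onto `D`.
(Every immersed submanifold of `Q` arises from some `L` in the universe of `Q`.) -/
def IsConnectedIntegralManifold (D : ∀ q : Q, Submodule ℝ (TangentSpace 𝓘(ℝ, E) q))
    (S : Set Q) : Prop :=
  ∃ (d : ℕ) (L : Type u) (_ : TopologicalSpace L)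
    (_ : ChartedSpace (EuclideanSpace ℝ (Fin d)) L) (j : L → Q),
    IsManifold 𝓘(ℝ, EuclideanSpace ℝ (Fin d)) ∞ L ∧
    T2Space L ∧ SecondCountableTopology L ∧ ConnectedSpace L ∧
    Manifold.IsImmersion 𝓘(ℝ, EuclideanSpace ℝ (Fin d)) 𝓘(ℝ, E) ∞ j ∧
    Function.Injective j ∧ Set.range j = S ∧
    ∀ x : L, (mfderiv 𝓘(ℝ, EuclideanSpace ℝ (Fin d)) 𝓘(ℝ, E) j x).range = D (j x)

/-- The leaves of the foliation tangent to `D`: the maximal connected integral manifolds. -/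
def IsLeaf (D : ∀ q : Q, Submodule ℝ (TangentSpace 𝓘(ℝ, E) q)) (S : Set Q) : Prop :=
  Maximal (IsConnectedIntegralManifold D) S

/-- `π : Q → N` exhibits `N` as the quotient of `Q` obtained by identifying all points on a leaf:
it is onto, and its fibres are exactly the leaves. -/
structure IsLeafSpaceProjection (D : ∀ q : Q, Submodule ℝ (TangentSpace 𝓘(ℝ, E) q))
    {N : Type*} (π : Q → N) : Prop where
  surjective : Function.Surjective π
  isLeaf_iff : ∀ S : Set Q, IsLeaf D S ↔ ∃ y : N, π ⁻¹' {y} = S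

end Distributions

/-- The characteristic distribution `(TQ)^Ω ∩ TQ` of an immersed submanifold `ι : Q → M`: the
tangent vectors of `Q` that lie, as vectors of `TM`, in the `Ω`-orthogonal complement of `TQ`. -/
def charDistribution {EM : Type*} [NormedAddCommGroup EM] [NormedSpace ℝ EM]
    {M : Type*} [TopologicalSpace M] [ChartedSpace EM M]
    {EQ : Type*} [NormedAddCommGroup EQ] [NormedSpace ℝ EQ]
    {Q : Type*} [TopologicalSpace Q] [ChartedSpace EQ Q]
    (Ω : DiffForm EM M 2) (ι : Q → M) (q : Q) : Submodule ℝ (TangentSpace 𝓘(ℝ, EQ) q) :=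
  (orthogonal Ω (ι q) (mfderiv 𝓘(ℝ, EQ) 𝓘(ℝ, EM) ι q).range).comap
    (mfderiv 𝓘(ℝ, EQ) 𝓘(ℝ, EM) ι q).toLinearMap

end

end LCSReduction

/-!
Write `Θ = ι^*Ω`. By definition the characteristic distribution `D` is the kernel of `Θ`.

The first point is that `D` is the vertical distribution of `π`
(`IsLeafSpaceProjection.eq_ker`). A leaf is the image of an injective immersion `j` with `π ∘ j`
constant, so `D` is vertical. Conversely, the leaf is second countable and fills the whole fibre,
and a smooth map does not raise the Hausdorff dimension, so the dimension of the fibre is at most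
that of the leaf, which is the rank of `D`.

If `Θ = π^*τ` with `τ` locally conformal symplectic, choose `h > 0` near `π q` with `h τ` closed.
Then `(h ∘ π) Θ` is closed near `q`. For `v ∈ D` both `Θ(v, ·)` and `d(h ∘ π)(v)` vanish, and
`dΘ = ι^*η ∧ Θ`, so contracting `d((h ∘ π) Θ) = 0` with `v` leaves `h (ι^*η)(v) Θ = 0`. Since `N`
has positive dimension, `Θ ≠ 0`, and so `(ι^*η)(v) = 0` (`lee_eq_zero_of_pullback_eq`).

Conversely, suppose that `ι^*η` vanishes on the sections of `D`. Every vertical vector extends to a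
global vertical vector field (`exists_vertical_section`), so `ι^*η` vanishes on `D` pointwise, and
`dΘ = ι^*η ∧ Θ` vanishes when contracted with a vertical vector, as does `Θ` itself. In charts in
which `π` is a projection this says that the coefficients of `Θ` do not depend on the fibre
coordinates (`eventually_descendsAt_iff`). The fibres being connected, `Θ = π^*τ` for a form `τ` on
`N` (`exists_pullback_eq`). For a local section `s` of `π` we get `τ = (ι ∘ s)^*Ω`, which makes `τ`
smooth and locally conformally closed; it is nondegenerate because the kernel of `Θ` is vertical
(`isLCSForm_of_pullback_eq`).

The form `τ` is compared with `Ω` through `extD_pullback`: the exterior derivative, defined through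
the preferred chart at each point, commutes with pullbacks.
-/

namespace LCSReduction

universe u

/-! ### Pullbacks and exterior derivatives of forms -/

section Calculus

variable {E : Type*} [NormedAddCommGroup E] [NormedSpace ℝ E]
  {M : Type*} [TopologicalSpace M] [ChartedSpace E M]
  {E' : Type*} [NormedAddCommGroup E'] [NormedSpace ℝ E']
  {M' : Type*} [TopologicalSpace M'] [ChartedSpace E' M']
  {E'' : Type*} [NormedAddCommGroup E''] [NormedSpace ℝ E'']
  {M'' : Type*} [TopologicalSpace M''] [ChartedSpace E'' M'']

/-- Alternatization of continuous multilinear maps, as a continuous linear map. -/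
noncomputable def alternatizationCLM (V : Type*) [NormedAddCommGroup V] [NormedSpace ℝ V] (k : ℕ) :
    ContinuousMultilinearMap ℝ (fun _ : Fin k => V) ℝ →L[ℝ] V [⋀^Fin k]→L[ℝ] ℝ :=
  LinearMap.mkContinuous
    { toFun := ContinuousMultilinearMap.alternatization
      map_add' := map_add _
      map_smul' := fun c m => by
        ext v
        simp [ContinuousMultilinearMap.alternatization_apply_apply, Finset.mul_sum, mul_smul_comm] }
    (Fintype.card (Equiv.Perm (Fin k))) (fun m => by
      refine ContinuousAlternatingMap.opNorm_le_bound _ (by positivity) fun v => ?_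
      simp only [LinearMap.coe_mk, AddHom.coe_mk,
        ContinuousMultilinearMap.alternatization_apply_apply]
      refine (norm_sum_le _ _).trans ?_
      rw [mul_assoc, ← nsmul_eq_mul, ← Finset.card_univ]
      refine Finset.sum_le_card_nsmul _ _ _ fun σ _ => ?_
      have h1 : ‖Equiv.Perm.sign σ • m (v ∘ σ)‖ = ‖m (v ∘ σ)‖ := by
        rcases Int.units_eq_one_or (Equiv.Perm.sign σ) with h | h <;> simp [h]
      rw [h1]
      refine (m.le_opNorm _).trans_eq ?_
      congr 1
      exact Equiv.prod_comp σ fun i => ‖v i‖)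

/-- Up to the factor `k!`, alternatization is a left inverse of the inclusion of alternating maps in
multilinear maps. -/
theorem alternatizationCLM_coe {k : ℕ} (β : E [⋀^Fin k]→L[ℝ] ℝ) :
    alternatizationCLM E k β.toContinuousMultilinearMap =
      (Fintype.card (Equiv.Perm (Fin k)) : ℝ) • β := by
  ext v
  change ContinuousMultilinearMap.alternatization β.toContinuousMultilinearMap v = _
  rw [ContinuousMultilinearMap.alternatization_apply_apply]
  have : ∀ σ : Equiv.Perm (Fin k),
      Equiv.Perm.sign σ • β.toContinuousMultilinearMap (v ∘ σ) = β v := fun σ => by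
    have := β.toAlternatingMap.map_perm v σ
    change β (v ∘ σ) = Equiv.Perm.sign σ • β v at this
    change Equiv.Perm.sign σ • β (v ∘ σ) = β v
    rw [this, smul_smul, Int.units_mul_self, one_smul]
  rw [Finset.sum_congr rfl fun σ _ => this σ]
  simp

/-- Pulling back an alternating form along a linear map is smooth in the form and the map. -/
theorem contDiff_compContinuousLinearMap {k : ℕ} {n : WithTop ℕ∞} :
    ContDiff ℝ n fun p : (E' [⋀^Fin k]→L[ℝ] ℝ) × (E →L[ℝ] E') =>
      p.1.compContinuousLinearMap p.2 := by
  have h1 : ContDiff ℝ n fun p : (E' [⋀^Fin k]→L[ℝ] ℝ) × (E →L[ℝ] E') =>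
      ContinuousMultilinearMap.compContinuousLinearMapContinuousMultilinear ℝ
        (fun _ : Fin k => E) (fun _ => E') ℝ (fun _ => p.2)
        (ContinuousAlternatingMap.toContinuousMultilinearMapCLM ℝ p.1) := by
    refine ContDiff.clm_apply ?_ ?_
    · exact (ContinuousMultilinearMap.contDiff _).comp (contDiff_pi.2 fun _ => contDiff_snd)
    · exact (ContinuousLinearMap.contDiff _).comp contDiff_fst
  have h2 := ((alternatizationCLM E k).contDiff.comp h1).const_smul
    ((Fintype.card (Equiv.Perm (Fin k)) : ℝ)⁻¹)
  convert h2 using 1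
  funext p
  have := alternatizationCLM_coe (p.1.compContinuousLinearMap p.2)
  have hc : (Fintype.card (Equiv.Perm (Fin k)) : ℝ) ≠ 0 := by
    exact_mod_cast Fintype.card_ne_zero
  rw [eq_comm, inv_smul_eq_iff₀ hc, ← this]
  rfl

theorem eventually_mdifferentiableAt [IsManifold 𝓘(ℝ, E) ∞ M] [IsManifold 𝓘(ℝ, E') ∞ M']
    {f : M → M'} {x : M} (hf : ContMDiffAt 𝓘(ℝ, E) 𝓘(ℝ, E') ∞ f x) :
    ∀ᶠ y in 𝓝 x, MDifferentiableAt 𝓘(ℝ, E) 𝓘(ℝ, E') f y := by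
  have : IsManifold 𝓘(ℝ, E) 1 M := .of_le (n := ∞) (by simp)
  have : IsManifold 𝓘(ℝ, E') 1 M' := .of_le (n := ∞) (by simp)
  have h1 : ContMDiffAt 𝓘(ℝ, E) 𝓘(ℝ, E') 1 f x := hf.of_le (by simp)
  filter_upwards [(contMDiffAt_iff_contMDiffAt_nhds (by simp)).1 h1] with y hy
  exact hy.mdifferentiableAt (by simp)

theorem pullback_comp {k : ℕ} {f : M → M'} {g : M' → M''} (θ : DiffForm E'' M'' k) {x : M}
    (hg : MDifferentiableAt 𝓘(ℝ, E') 𝓘(ℝ, E'') g (f x))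
    (hf : MDifferentiableAt 𝓘(ℝ, E) 𝓘(ℝ, E') f x) :
    pullback (E := E) (g ∘ f) θ x = pullback (E := E) f (pullback (E := E') g θ) x := by
  simp only [pullback]
  rw [mfderiv_comp x hg hf]
  rfl

theorem pullback_congr {k : ℕ} {f g : M → M'} (θ : DiffForm E' M' k) {x : M} (h : f =ᶠ[𝓝 x] g) :
    pullback (E := E) f θ x = pullback (E := E) g θ x := by
  simp only [pullback]
  have e1 := h.eq_of_nhds
  have e2 : (mfderiv 𝓘(ℝ, E) 𝓘(ℝ, E') f x : E →L[ℝ] E') = mfderiv 𝓘(ℝ, E) 𝓘(ℝ, E') g x :=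
    h.mfderiv_eq
  have key : ∀ (y : M') (A B : E →L[ℝ] E'), f x = y → A = B →
      (θ (f x) : E' [⋀^Fin k]→L[ℝ] ℝ).compContinuousLinearMap A =
        (θ y : E' [⋀^Fin k]→L[ℝ] ℝ).compContinuousLinearMap B := by
    rintro y A B rfl rfl
    rfl
  exact key _ _ _ e1 e2

theorem pullback_id {k : ℕ} (θ : DiffForm E M k) (x : M) : pullback (E := E) id θ x = θ x := by
  simp only [pullback, mfderiv_id]
  ext v
  rfl

theorem pullback_smulForm {k : ℕ} (f : M → M') (g : M' → ℝ) (θ : DiffForm E' M' k) :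
    pullback (E := E) f (smulForm g θ) = smulForm (g ∘ f) (pullback (E := E) f θ) := rfl

/-- A pullback to a vector space, in terms of the coordinate expression of the form. -/
theorem pullback_eventuallyEq_inChart [IsManifold 𝓘(ℝ, E') ∞ M'] {k : ℕ} {g : E → M'}
    (θ : DiffForm E' M' k) {y : E} (hg : ContMDiffAt 𝓘(ℝ, E) 𝓘(ℝ, E') ∞ g y) :
    (pullback (E := E) g θ : E → E [⋀^Fin k]→L[ℝ] ℝ) =ᶠ[𝓝 y] fun z =>
      (inChart θ (g y) (extChartAt 𝓘(ℝ, E') (g y) (g z))).compContinuousLinearMap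
        (fderiv ℝ (fun z => extChartAt 𝓘(ℝ, E') (g y) (g z)) z) := by
  set c := extChartAt 𝓘(ℝ, E') (g y)
  have hs : ∀ᶠ z in 𝓝 y, g z ∈ c.source :=
    hg.continuousAt.preimage_mem_nhds (extChartAt_source_mem_nhds (g y))
  have hsm := eventually_mdifferentiableAt hg
  filter_upwards [hs.eventually_nhds, hsm] with z hz hgd
  have hz0 := hz.self_of_nhds
  have hcs : z ∈ g ⁻¹' (chartAt E' (g y)).source := by simpa [c] using hz0
  have hc : MDifferentiableAt 𝓘(ℝ, E') 𝓘(ℝ, E') c (g z) :=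
    mdifferentiableAt_extChartAt hcs
  have hcsymm : MDifferentiableAt 𝓘(ℝ, E') 𝓘(ℝ, E') c.symm (c (g z)) := by
    have := mdifferentiableWithinAt_extChartAt_symm (I := 𝓘(ℝ, E')) (c.map_source hz0)
    rwa [modelWithCornersSelf_coe, Set.range_id, mdifferentiableWithinAt_univ] at this
  have e : g =ᶠ[𝓝 z] c.symm ∘ (c ∘ g) := by
    filter_upwards [hz] with w hw
    exact (c.left_inv hw).symm
  refine (pullback_congr θ e).trans
    ((pullback_comp (f := c ∘ g) (g := c.symm) θ hcsymm (hc.comp z hgd)).trans ?_)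
  simp only [pullback, mfderiv_eq_fderiv]
  rfl

/-- Pulling back a smooth form along a smooth map from a vector space gives a smooth form. -/
theorem contDiffAt_pullback [IsManifold 𝓘(ℝ, E') ∞ M'] {k : ℕ} {g : E → M'}
    {θ : DiffForm E' M' k} {U : Set M'} (hU : IsOpen U) (hθ : SmoothFormOn θ U) {y : E}
    (hy : g y ∈ U) (hg : ContMDiffAt 𝓘(ℝ, E) 𝓘(ℝ, E') ∞ g y) :
    ContDiffAt ℝ ∞ (F := E [⋀^Fin k]→L[ℝ] ℝ) (pullback (E := E) g θ) y := by
  refine ContDiffAt.congr_of_eventuallyEq ?_ (pullback_eventuallyEq_inChart θ hg)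
  have hG : ContDiffAt ℝ ∞ (fun z => extChartAt 𝓘(ℝ, E') (g y) (g z)) y := by
    rw [← contMDiffAt_iff_contDiffAt]
    exact (contMDiffAt_extChartAt (x := g y)).comp y hg
  have hθ' : ContDiffAt ℝ ∞ (inChart θ (g y)) (extChartAt 𝓘(ℝ, E') (g y) (g y)) := by
    refine (hθ (g y)).contDiffAt (Filter.inter_mem (extChartAt_target_mem_nhds _) ?_)
    exact (continuousAt_extChartAt_symm (g y)).preimage_mem_nhds
      (hU.mem_nhds (by simpa using hy))
  have h1 := hθ'.comp y hG
  have h2 : ContDiffAt ℝ ∞ (fderiv ℝ fun z => extChartAt 𝓘(ℝ, E') (g y) (g z)) y :=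
    hG.fderiv_right (by simp)
  exact (contDiff_compContinuousLinearMap.contDiffAt).comp y (h1.prodMk h2)

/-- On a vector space the exterior derivative of a form on a manifold is the usual one. -/
theorem extD_eq_extDeriv {k : ℕ} (θ : DiffForm E E k) (x : E) :
    extD θ x = extDeriv (θ : E → E [⋀^Fin k]→L[ℝ] ℝ) x := by
  have h : inChart θ x = θ := by
    funext y
    simp only [inChart]
    rw [extChartAt_model_space_eq_id]
    exact pullback_id θ y
  simp only [extD, h, extChartAt_model_space_eq_id]
  change (extDeriv (θ : E → E [⋀^Fin k]→L[ℝ] ℝ) x).compContinuousLinearMap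
    (mfderiv 𝓘(ℝ, E) 𝓘(ℝ, E) id x) = _
  rw [mfderiv_id]
  ext v
  rfl

theorem extD_congr {k : ℕ} {θ θ' : DiffForm E M k} {x : M} (h : ∀ᶠ y in 𝓝 x, θ y = θ' y) :
    extD θ x = extD θ' x := by
  have e : inChart θ x =ᶠ[𝓝 (extChartAt 𝓘(ℝ, E) x x)] inChart θ' x := by
    have := (continuousAt_extChartAt_symm (I := 𝓘(ℝ, E)) x)
    have h' : ∀ᶠ y in 𝓝 ((extChartAt 𝓘(ℝ, E) x).symm (extChartAt 𝓘(ℝ, E) x x)), θ y = θ' y := by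
      simpa using h
    filter_upwards [this.eventually h'] with y hy
    simp only [inChart]
    rw [hy]
  simp only [extD]
  rw [e.extDeriv_eq]

/-- The exterior derivative commutes with pullbacks. -/
theorem extD_pullback [IsManifold 𝓘(ℝ, E) ∞ M] [IsManifold 𝓘(ℝ, E') ∞ M'] {k : ℕ} {f : M → M'}
    {θ : DiffForm E' M' k} {U : Set M'} (hU : IsOpen U) (hθ : SmoothFormOn θ U) {x : M}
    (hx : f x ∈ U) (hf : ContMDiffAt 𝓘(ℝ, E) 𝓘(ℝ, E') ∞ f x) :
    extD (pullback (E := E) f θ) x = pullback (E := E) f (extD θ) x := by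
  set c := extChartAt 𝓘(ℝ, E) x
  set c' := extChartAt 𝓘(ℝ, E') (f x)
  have hcx : c.symm (c x) = x := by simp [c]
  have hsymm : ContMDiffAt 𝓘(ℝ, E) 𝓘(ℝ, E) ∞ c.symm (c x) :=
    (contMDiffOn_extChartAt_symm x).contMDiffAt (extChartAt_target_mem_nhds x)
  have hf' : ContMDiffAt 𝓘(ℝ, E) 𝓘(ℝ, E') ∞ f (c.symm (c x)) := by rwa [hcx]
  have hg : ContMDiffAt 𝓘(ℝ, E) 𝓘(ℝ, E') ∞ (f ∘ c.symm) (c x) := hf'.comp _ hsymm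
  have e1 : inChart (pullback (E := E) f θ) x =ᶠ[𝓝 (c x)] pullback (E := E) (f ∘ c.symm) θ := by
    have h1 := eventually_mdifferentiableAt hsymm
    have h2 := hsymm.continuousAt.eventually (eventually_mdifferentiableAt hf')
    filter_upwards [h1, h2] with z hz1 hz2
    exact (pullback_comp θ hz2
      hz1).symm
  have e2 := e1.trans (pullback_eventuallyEq_inChart θ hg)
  have hfx : (f ∘ c.symm) (c x) = f x := by simp [hcx]
  rw [hfx] at e2
  have hG : ContMDiffAt 𝓘(ℝ, E) 𝓘(ℝ, E') ∞ (fun z => c' ((f ∘ c.symm) z)) (c x) := by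
    have : ContMDiffAt 𝓘(ℝ, E') 𝓘(ℝ, E') ∞ c' ((f ∘ c.symm) (c x)) := by
      rw [hfx]; exact contMDiffAt_extChartAt
    exact this.comp _ hg
  have hθ' : ContDiffAt ℝ ∞ (inChart θ (f x)) (c' ((f ∘ c.symm) (c x))) := by
    rw [hfx]
    refine (hθ (f x)).contDiffAt (Filter.inter_mem (extChartAt_target_mem_nhds _) ?_)
    exact (continuousAt_extChartAt_symm (f x)).preimage_mem_nhds
      (hU.mem_nhds (by simpa using hx))
  simp only [extD]
  rw [e2.extDeriv_eq, extDeriv_pullback (f := fun z => c' ((f ∘ c.symm) z))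
    (hθ'.differentiableAt (by simp)) hG.contDiffAt (r := ∞)
    (by rw [minSmoothness_of_isRCLikeNormedField]; exact WithTop.coe_le_coe.2 le_top), hfx]
  simp only [pullback, extD]
  have hd : (mfderiv 𝓘(ℝ, E) 𝓘(ℝ, E') (c' ∘ f) x : E →L[ℝ] E') =
      (fderiv ℝ (fun z => c' ((f ∘ c.symm) z)) (c x)) ∘L
        (mfderiv 𝓘(ℝ, E) 𝓘(ℝ, E) c x : E →L[ℝ] E) := by
    rw [← mfderiv_eq_fderiv]
    have := mfderiv_comp x (hG.mdifferentiableAt (by simp))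
      ((contMDiffAt_extChartAt (n := ∞) (x := x) (I := 𝓘(ℝ, E))).mdifferentiableAt (by simp))
    refine Eq.trans ?_ this
    refine Filter.EventuallyEq.mfderiv_eq ?_
    filter_upwards [extChartAt_source_mem_nhds (I := 𝓘(ℝ, E)) x] with z hz
    simp only [Function.comp_apply]
    rw [c.left_inv hz]
  have hd2 : (mfderiv 𝓘(ℝ, E) 𝓘(ℝ, E') (c' ∘ f) x : E →L[ℝ] E') =
      (mfderiv 𝓘(ℝ, E') 𝓘(ℝ, E') c' (f x) : E' →L[ℝ] E') ∘L mfderiv 𝓘(ℝ, E) 𝓘(ℝ, E') f x :=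
    mfderiv_comp x ((contMDiffAt_extChartAt (n := ∞) (x := f x)
      (I := 𝓘(ℝ, E'))).mdifferentiableAt (by simp)) (hf.mdifferentiableAt (by simp))
  have hd3 := hd.symm.trans hd2
  ext v
  have hv : ∀ i, (fderiv ℝ (fun z => c' ((f ∘ c.symm) z)) (c x))
        ((mfderiv 𝓘(ℝ, E) 𝓘(ℝ, E) c x : E →L[ℝ] E) (v i)) =
      (mfderiv 𝓘(ℝ, E') 𝓘(ℝ, E') c' (f x) : E' →L[ℝ] E')
        (mfderiv 𝓘(ℝ, E) 𝓘(ℝ, E') f x (v i)) := fun i => DFunLike.congr_fun hd3 (v i)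
  exact congrArg _ (funext hv)

/-- A form that is locally a pullback of a smooth form is smooth. -/
theorem smoothFormOn_of_pullback [IsManifold 𝓘(ℝ, E) ∞ M] [IsManifold 𝓘(ℝ, E') ∞ M'] {k : ℕ}
    {θ : DiffForm E M k} {θ' : DiffForm E' M' k} {f : M → M'} {U : Set M} {U' : Set M'}
    (hU' : IsOpen U') (hθ' : SmoothFormOn θ' U')
    (h : ∀ x ∈ U, f x ∈ U' ∧ ContMDiffAt 𝓘(ℝ, E) 𝓘(ℝ, E') ∞ f x ∧
      ∀ᶠ y in 𝓝 x, θ y = pullback (E := E) f θ' y) :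
    SmoothFormOn θ U := by
  rintro x₀ y ⟨hy, hyU⟩
  set c := extChartAt 𝓘(ℝ, E) x₀
  obtain ⟨h1, h2, h3⟩ := h _ hyU
  have hsymm : ContMDiffAt 𝓘(ℝ, E) 𝓘(ℝ, E) ∞ c.symm y :=
    (contMDiffOn_extChartAt_symm x₀).contMDiffAt ((isOpen_extChartAt_target x₀).mem_nhds hy)
  have hg : ContMDiffAt 𝓘(ℝ, E) 𝓘(ℝ, E') ∞ (f ∘ c.symm) y := h2.comp _ hsymm
  have e1 : inChart θ x₀ =ᶠ[𝓝 y] pullback (E := E) (f ∘ c.symm) θ' := by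
    have h1 := eventually_mdifferentiableAt hsymm
    have h2 := hsymm.continuousAt.eventually (eventually_mdifferentiableAt h2)
    filter_upwards [h1, h2, hsymm.continuousAt.eventually h3] with z hz1 hz2 hz3
    rw [pullback_comp θ' hz2 hz1]
    simp only [inChart, pullback] at hz3 ⊢
    rw [hz3]
    rfl
  refine ContDiffAt.contDiffWithinAt ?_
  exact (contDiffAt_pullback (g := f ∘ c.symm) hU' hθ' h1 hg).congr_of_eventuallyEq e1

end Calculus

/-! ### Submersions and immersions -/

section Submersion

variable {EQ : Type u} [NormedAddCommGroup EQ] [NormedSpace ℝ EQ]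
  {Q : Type*} [TopologicalSpace Q] [ChartedSpace EQ Q]
  {EN : Type*} [NormedAddCommGroup EN] [NormedSpace ℝ EN]
  {N : Type*} [TopologicalSpace N] [ChartedSpace EN N]

/-- Charts of `Q` and `N`, with values in `EN × K` and `EN`, in which `π : Q → N` is the first
projection. -/
structure SubmersionChart (π : Q → N) (K : Type*) [NormedAddCommGroup K] [NormedSpace ℝ K] where
  dom : OpenPartialHomeomorph Q (EN × K)
  cod : OpenPartialHomeomorph N EN
  contMDiffOn_dom : ContMDiffOn 𝓘(ℝ, EQ) 𝓘(ℝ, EN × K) ∞ dom dom.source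
  contMDiffOn_dom_symm : ContMDiffOn 𝓘(ℝ, EN × K) 𝓘(ℝ, EQ) ∞ dom.symm dom.target
  contMDiffOn_cod : ContMDiffOn 𝓘(ℝ, EN) 𝓘(ℝ, EN) ∞ cod cod.source
  contMDiffOn_cod_symm : ContMDiffOn 𝓘(ℝ, EN) 𝓘(ℝ, EN) ∞ cod.symm cod.target
  map_source : ∀ q ∈ dom.source, π q ∈ cod.source
  fst_dom : ∀ q ∈ dom.source, (dom q).1 = cod (π q)

theorem exists_submersionChart [FiniteDimensional ℝ EQ] {π : Q → N}
    (hπ : Manifold.IsSubmersion 𝓘(ℝ, EQ) 𝓘(ℝ, EN) ∞ π) (q : Q) :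
    ∃ (K : Type u) (_ : NormedAddCommGroup K) (_ : NormedSpace ℝ K) (_ : FiniteDimensional ℝ K)
      (c : SubmersionChart (EQ := EQ) (EN := EN) π K), q ∈ c.dom.source := by
  have h := hπ.isSubmersionAt q
  let e := h.equiv
  have : FiniteDimensional ℝ h.complement :=
    FiniteDimensional.of_surjective (V := EQ)
      ((LinearMap.snd ℝ EN h.complement).comp e.toLinearEquiv.toLinearMap)
      (fun k => ⟨e.symm (0, k), by simp⟩)
  have he : ContMDiff 𝓘(ℝ, EQ) 𝓘(ℝ, EN × h.complement) ∞ e := e.contDiff.contMDiff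
  have hes : ContMDiff 𝓘(ℝ, EN × h.complement) 𝓘(ℝ, EQ) ∞ e.symm := e.symm.contDiff.contMDiff
  refine ⟨h.complement, inferInstance, inferInstance, this,
    { dom := h.domChart.trans e.toHomeomorph.toOpenPartialHomeomorph
      cod := h.codChart
      contMDiffOn_dom := ?_
      contMDiffOn_dom_symm := ?_
      contMDiffOn_cod := contMDiffOn_of_mem_maximalAtlas h.codChart_mem_maximalAtlas
      contMDiffOn_cod_symm := contMDiffOn_symm_of_mem_maximalAtlas h.codChart_mem_maximalAtlas
      map_source := fun x hx => h.source_subset_preimage_source (by simpa using hx)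
      fst_dom := fun x hx => ?_ }, ?_⟩
  · simpa using he.comp_contMDiffOn (contMDiffOn_of_mem_maximalAtlas h.domChart_mem_maximalAtlas)
  · simpa using (contMDiffOn_symm_of_mem_maximalAtlas h.domChart_mem_maximalAtlas).comp
      (hes.contMDiffOn (s := e.symm ⁻¹' h.domChart.target)) (fun x hx => hx)
  · have hx' : x ∈ h.domChart.source := by simpa using hx
    have := h.writtenInCharts (show h.domChart x ∈ (h.domChart.extend 𝓘(ℝ, EQ)).target by
      simpa using h.domChart.map_source hx')
    simpa [hx'] using this.symm
  · simpa using h.mem_domChart_source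

namespace SubmersionChart

variable {π : Q → N} {K : Type*} [NormedAddCommGroup K] [NormedSpace ℝ K]
  (c : SubmersionChart (EQ := EQ) (EN := EN) π K)

theorem mdifferentiable_dom : c.dom.MDifferentiable 𝓘(ℝ, EQ) 𝓘(ℝ, EN × K) :=
  ⟨c.contMDiffOn_dom.mdifferentiableOn (by simp),
    c.contMDiffOn_dom_symm.mdifferentiableOn (by simp)⟩

theorem mdifferentiable_cod : c.cod.MDifferentiable 𝓘(ℝ, EN) 𝓘(ℝ, EN) :=
  ⟨c.contMDiffOn_cod.mdifferentiableOn (by simp),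
    c.contMDiffOn_cod_symm.mdifferentiableOn (by simp)⟩

theorem contMDiffAt_dom_symm {z : EN × K} (hz : z ∈ c.dom.target) :
    ContMDiffAt 𝓘(ℝ, EN × K) 𝓘(ℝ, EQ) ∞ c.dom.symm z :=
  c.contMDiffOn_dom_symm.contMDiffAt (c.dom.open_target.mem_nhds hz)

theorem apply_dom_symm {z : EN × K} (hz : z ∈ c.dom.target) :
    π (c.dom.symm z) = c.cod.symm z.1 := by
  have h := c.dom.map_target hz
  have h1 := c.fst_dom _ h
  rw [c.dom.right_inv hz] at h1
  rw [h1, c.cod.left_inv (c.map_source _ h)]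

theorem fst_mem_target {z : EN × K} (hz : z ∈ c.dom.target) : z.1 ∈ c.cod.target := by
  have h := c.dom.map_target hz
  have h1 := c.fst_dom _ h
  rw [c.dom.right_inv hz] at h1
  rw [h1]
  exact c.cod.map_source (c.map_source _ h)

/-- In submersion charts the differential of `π` depends on the base coordinate only. -/
theorem mfderiv_comp_dom_symm {z : EN × K} (hz : z ∈ c.dom.target)
    (hπ : MDifferentiableAt 𝓘(ℝ, EQ) 𝓘(ℝ, EN) π (c.dom.symm z)) (v : EN × K) :
    mfderiv 𝓘(ℝ, EQ) 𝓘(ℝ, EN) π (c.dom.symm z) (mfderiv 𝓘(ℝ, EN × K) 𝓘(ℝ, EQ) c.dom.symm z v) =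
      mfderiv 𝓘(ℝ, EN) 𝓘(ℝ, EN) c.cod.symm z.1 v.1 := by
  have h1 := mfderiv_comp z hπ (c.mdifferentiable_dom.mdifferentiableAt_symm hz)
  have hfst : MDifferentiableAt 𝓘(ℝ, EN × K) 𝓘(ℝ, EN) (Prod.fst : EN × K → EN) z :=
    differentiableAt_fst.mdifferentiableAt
  have h2 := mfderiv_comp z
    (c.mdifferentiable_cod.mdifferentiableAt_symm (c.fst_mem_target hz)) hfst
  have e : π ∘ c.dom.symm =ᶠ[𝓝 z] c.cod.symm ∘ Prod.fst := by
    filter_upwards [c.dom.open_target.mem_nhds hz] with w hw using c.apply_dom_symm hw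
  have h3 := DFunLike.congr_fun (h1.symm.trans (e.mfderiv_eq.trans h2)) v
  refine h3.trans ?_
  simp only [mfderiv_eq_fderiv, fderiv_fst]
  rfl

theorem mfderiv_symm_mfderiv {q : Q} (hq : q ∈ c.dom.source) (v : TangentSpace 𝓘(ℝ, EQ) q) :
    mfderiv 𝓘(ℝ, EN × K) 𝓘(ℝ, EQ) c.dom.symm (c.dom q)
      (mfderiv 𝓘(ℝ, EQ) 𝓘(ℝ, EN × K) c.dom q v) = v :=
  DFunLike.congr_fun (c.mdifferentiable_dom.symm_comp_deriv hq) v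

/-- The differential of `π` is, in submersion charts, the first projection. -/
theorem fst_mfderiv_dom {q : Q} (hq : q ∈ c.dom.source)
    (hπ : MDifferentiableAt 𝓘(ℝ, EQ) 𝓘(ℝ, EN) π q) (v : TangentSpace 𝓘(ℝ, EQ) q) :
    (mfderiv 𝓘(ℝ, EQ) 𝓘(ℝ, EN × K) c.dom q v : EN × K).1 =
      mfderiv 𝓘(ℝ, EN) 𝓘(ℝ, EN) c.cod (π q) (mfderiv 𝓘(ℝ, EQ) 𝓘(ℝ, EN) π q v) := by
  have hfst : MDifferentiableAt 𝓘(ℝ, EN × K) 𝓘(ℝ, EN) (Prod.fst : EN × K → EN) (c.dom q) :=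
    differentiableAt_fst.mdifferentiableAt
  have h1 := mfderiv_comp q hfst (c.mdifferentiable_dom.mdifferentiableAt hq)
  have h2 := mfderiv_comp q (c.mdifferentiable_cod.mdifferentiableAt (c.map_source q hq)) hπ
  have e : Prod.fst ∘ c.dom =ᶠ[𝓝 q] c.cod ∘ π := by
    filter_upwards [c.dom.open_source.mem_nhds hq] with w hw using c.fst_dom w hw
  have h3 := DFunLike.congr_fun (h1.symm.trans (e.mfderiv_eq.trans h2)) v
  refine Eq.trans ?_ h3
  simp only [mfderiv_eq_fderiv, fderiv_fst]
  rfl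

/-- Vertical vectors are the images of the vectors of the second factor. -/
theorem exists_of_mfderiv_eq_zero {q : Q} (hq : q ∈ c.dom.source)
    (hπ : MDifferentiableAt 𝓘(ℝ, EQ) 𝓘(ℝ, EN) π q) (v : TangentSpace 𝓘(ℝ, EQ) q)
    (hv : mfderiv 𝓘(ℝ, EQ) 𝓘(ℝ, EN) π q v = 0) :
    v = mfderiv 𝓘(ℝ, EN × K) 𝓘(ℝ, EQ) c.dom.symm (c.dom q)
      ((0, (mfderiv 𝓘(ℝ, EQ) 𝓘(ℝ, EN × K) c.dom q v : EN × K).2) : EN × K) := by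
  have h := c.fst_mfderiv_dom hq hπ v
  rw [hv, map_zero] at h
  have e : ((0, (mfderiv 𝓘(ℝ, EQ) 𝓘(ℝ, EN × K) c.dom q v : EN × K).2) : EN × K) =
      mfderiv 𝓘(ℝ, EQ) 𝓘(ℝ, EN × K) c.dom q v := Prod.ext h.symm rfl
  rw [e]
  exact (c.mfderiv_symm_mfderiv hq v).symm

theorem finrank_ker_le [FiniteDimensional ℝ K] {q : Q} (hq : q ∈ c.dom.source)
    (hπ : MDifferentiableAt 𝓘(ℝ, EQ) 𝓘(ℝ, EN) π q) :
    Module.finrank ℝ (mfderiv 𝓘(ℝ, EQ) 𝓘(ℝ, EN) π q).ker ≤ Module.finrank ℝ K := by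
  let L : (mfderiv 𝓘(ℝ, EQ) 𝓘(ℝ, EN) π q).ker →ₗ[ℝ] K :=
    ((LinearMap.snd ℝ EN K).comp
      (mfderiv 𝓘(ℝ, EQ) 𝓘(ℝ, EN × K) c.dom q : EQ →L[ℝ] EN × K).toLinearMap).comp
      (Submodule.subtype (mfderiv 𝓘(ℝ, EQ) 𝓘(ℝ, EN) π q).ker)
  refine LinearMap.finrank_le_finrank_of_injective (f := L) ?_
  rw [injective_iff_map_eq_zero]
  rintro ⟨v, hv⟩ h
  have h1 := c.exists_of_mfderiv_eq_zero hq hπ v hv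
  have h2 : (mfderiv 𝓘(ℝ, EQ) 𝓘(ℝ, EN × K) c.dom q v : EN × K).2 = 0 := h
  rw [h2] at h1
  exact Subtype.ext (h1.trans (map_zero _))

end SubmersionChart

/-- A submersion has a local section through every point. -/
theorem exists_localSection [FiniteDimensional ℝ EQ] {π : Q → N}
    (hπ : Manifold.IsSubmersion 𝓘(ℝ, EQ) 𝓘(ℝ, EN) ∞ π) (q : Q) :
    ∃ (s : N → Q) (V : Set N), IsOpen V ∧ π q ∈ V ∧ s (π q) = q ∧
      (∀ y ∈ V, ContMDiffAt 𝓘(ℝ, EN) 𝓘(ℝ, EQ) ∞ s y ∧ π (s y) = y) := by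
  obtain ⟨K, _, _, _, c, hq⟩ := exists_submersionChart hπ q
  have hcont : ContinuousOn (fun y => (c.cod y, (c.dom q).2)) c.cod.source :=
    c.cod.continuousOn.prodMk continuousOn_const
  have hV := hcont.isOpen_inter_preimage c.cod.open_source c.dom.open_target
  have hfst := c.fst_dom q hq
  have hqe : (c.cod (π q), (c.dom q).2) = c.dom q := Prod.ext hfst.symm rfl
  refine ⟨fun y => c.dom.symm (c.cod y, (c.dom q).2), _, hV, ⟨c.map_source q hq, ?_⟩, ?_, ?_⟩
  · change (c.cod (π q), (c.dom q).2) ∈ c.dom.target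
    rw [hqe]; exact c.dom.map_source hq
  · simp only [hqe, c.dom.left_inv hq]
  · rintro y ⟨hy1, hy2⟩
    refine ⟨?_, ?_⟩
    · have h1 : ContMDiffAt 𝓘(ℝ, EN) 𝓘(ℝ, EN × K) ∞ (fun y => (c.cod y, (c.dom q).2)) y :=
        (c.contMDiffOn_cod.contMDiffAt (c.cod.open_source.mem_nhds hy1)).prodMk_space
          contMDiffAt_const
      exact (c.contMDiffAt_dom_symm hy2).comp y h1
    · exact (c.apply_dom_symm hy2).trans (c.cod.left_inv hy1)

/-- The differential of a local section splits that of the submersion. -/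
theorem exists_rightInverse_mfderiv [FiniteDimensional ℝ EQ] {π : Q → N}
    (hπ : Manifold.IsSubmersion 𝓘(ℝ, EQ) 𝓘(ℝ, EN) ∞ π) (q : Q) :
    ∃ σ : EN →L[ℝ] EQ, ∀ v, mfderiv 𝓘(ℝ, EQ) 𝓘(ℝ, EN) π q (σ v) = v := by
  obtain ⟨s, V, hV, hqV, hs, h⟩ := exists_localSection hπ q
  refine ⟨mfderiv 𝓘(ℝ, EN) 𝓘(ℝ, EQ) s (π q), fun v => ?_⟩
  have h1 : MDifferentiableAt 𝓘(ℝ, EQ) 𝓘(ℝ, EN) π (s (π q)) :=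
    hπ.contMDiff.contMDiffAt.mdifferentiableAt (by simp)
  have h2 := mfderiv_comp (π q) h1 ((h _ hqV).1.mdifferentiableAt (by simp))
  have e : π ∘ s =ᶠ[𝓝 (π q)] id := by
    filter_upwards [hV.mem_nhds hqV] with y hy using (h y hy).2
  have h3 := DFunLike.congr_fun (h2.symm.trans (e.mfderiv_eq.trans mfderiv_id)) v
  rw [hs] at h3
  exact h3

end Submersion

/-- The differential of an immersion is injective. -/
theorem mfderiv_injective_of_isImmersion {E : Type*} [NormedAddCommGroup E] [NormedSpace ℝ E]
    {L : Type*} [TopologicalSpace L] [ChartedSpace E L]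
    {E' : Type*} [NormedAddCommGroup E'] [NormedSpace ℝ E']
    {Q : Type*} [TopologicalSpace Q] [ChartedSpace E' Q] {j : L → Q}
    (hj : Manifold.IsImmersion 𝓘(ℝ, E) 𝓘(ℝ, E') ∞ j) (x : L) :
    Function.Injective (mfderiv 𝓘(ℝ, E) 𝓘(ℝ, E') j x) := by
  have h := hj.isImmersionAt x
  have hjx : MDifferentiableAt 𝓘(ℝ, E) 𝓘(ℝ, E') j x :=
    hj.contMDiff.contMDiffAt.mdifferentiableAt (by simp)
  have hc : MDifferentiableAt 𝓘(ℝ, E') 𝓘(ℝ, E') h.codChart (j x) :=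
    (contMDiffAt_of_mem_maximalAtlas h.codChart_mem_maximalAtlas
      h.mem_codChart_source).mdifferentiableAt (by simp)
  have hd : MDifferentiableAt 𝓘(ℝ, E) 𝓘(ℝ, E) h.domChart x :=
    (contMDiffAt_of_mem_maximalAtlas h.domChart_mem_maximalAtlas
      h.mem_domChart_source).mdifferentiableAt (by simp)
  have hds : MDifferentiableAt 𝓘(ℝ, E) 𝓘(ℝ, E) h.domChart.symm (h.domChart x) :=
    (contMDiffAt_symm_of_mem_maximalAtlas h.domChart_mem_maximalAtlas
      (h.domChart.map_source h.mem_domChart_source)).mdifferentiableAt (by simp)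
  -- a local left inverse of `j`
  let p : E' →L[ℝ] E :=
    (ContinuousLinearMap.fst ℝ E h.complement).comp h.equiv.symm.toContinuousLinearMap
  have hp : MDifferentiableAt 𝓘(ℝ, E') 𝓘(ℝ, E) p (h.codChart (j x)) := p.mdifferentiableAt
  have e : ∀ y ∈ h.domChart.source, p (h.codChart (j y)) = h.domChart y := fun y hy => by
    have := h.writtenInCharts (show h.domChart y ∈ (h.domChart.extend 𝓘(ℝ, E)).target by
      simpa using h.domChart.map_source hy)
    have h' : h.codChart (j y) = h.equiv (h.domChart y, 0) := by simpa [hy] using this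
    simp [p, h']
  have hpc : MDifferentiableAt 𝓘(ℝ, E') 𝓘(ℝ, E) (p ∘ h.codChart) (j x) := hp.comp _ hc
  have hds' : MDifferentiableAt 𝓘(ℝ, E) 𝓘(ℝ, E) h.domChart.symm ((p ∘ h.codChart) (j x)) := by
    rw [Function.comp_apply, e x h.mem_domChart_source]; exact hds
  have h1 := mfderiv_comp x (hds'.comp (j x) hpc) hjx
  have e' : (h.domChart.symm ∘ (p ∘ h.codChart)) ∘ j =ᶠ[𝓝 x] id := by
    filter_upwards [h.domChart.open_source.mem_nhds h.mem_domChart_source] with y hy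
    simp only [Function.comp_apply, e y hy, h.domChart.left_inv hy, id]
  have h2 := h1.symm.trans (e'.mfderiv_eq.trans mfderiv_id)
  intro v w hvw
  have hv := DFunLike.congr_fun h2 v
  have hw := DFunLike.congr_fun h2 w
  refine hv.symm.trans (Eq.trans ?_ hw)
  exact congrArg (mfderiv 𝓘(ℝ, E') 𝓘(ℝ, E) (h.domChart.symm ∘ (p ∘ h.codChart)) (j x)) hvw

/-! ### Leaves as fibres of a submersion -/

/-- A `C¹` map on a part of a second countable manifold does not raise the dimension. -/
theorem dimH_image_le_finrank {E : Type*} [NormedAddCommGroup E] [NormedSpace ℝ E]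
    [FiniteDimensional ℝ E] {L : Type*} [TopologicalSpace L] [ChartedSpace E L]
    [IsManifold 𝓘(ℝ, E) ∞ L] [SecondCountableTopology L]
    {K : Type*} [NormedAddCommGroup K] [NormedSpace ℝ K] {g : L → K} {O : Set L}
    (hg : ∀ x ∈ O, ContMDiffAt 𝓘(ℝ, E) 𝓘(ℝ, K) 1 g x) :
    dimH (g '' O) ≤ Module.finrank ℝ E := by
  have hloc : ∀ x ∈ O, ∃ V ∈ 𝓝 x, dimH (g '' V) ≤ Module.finrank ℝ E := by
    intro x hx
    set c := extChartAt 𝓘(ℝ, E) x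
    have hcx : c.symm (c x) = x := by simp [c]
    have hsymm : ContMDiffAt 𝓘(ℝ, E) 𝓘(ℝ, E) 1 c.symm (c x) :=
      ((contMDiffOn_extChartAt_symm (n := ∞) x).contMDiffAt (extChartAt_target_mem_nhds x)).of_le
        (by simp)
    have h1 : ContMDiffAt 𝓘(ℝ, E) 𝓘(ℝ, K) 1 (g ∘ c.symm) (c x) := by
      refine ContMDiffAt.comp _ ?_ hsymm
      rw [hcx]; exact hg x hx
    obtain ⟨C, t, ht, hC⟩ := h1.contDiffAt.exists_lipschitzOnWith
    refine ⟨c.source ∩ c ⁻¹' t, Filter.inter_mem (extChartAt_source_mem_nhds x)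
      ((continuousAt_extChartAt x).preimage_mem_nhds ht), ?_⟩
    calc dimH (g '' (c.source ∩ c ⁻¹' t)) ≤ dimH ((g ∘ c.symm) '' t) := by
          refine dimH_mono ?_
          rintro _ ⟨z, ⟨hz, hzt⟩, rfl⟩
          exact ⟨c z, hzt, by simp [c.left_inv hz]⟩
      _ ≤ dimH t := hC.dimH_image_le
      _ ≤ dimH (Set.univ : Set E) := dimH_mono (Set.subset_univ _)
      _ = _ := Real.dimH_univ_eq_finrank E
  choose! V hV hdim using hloc
  obtain ⟨t, htO, htc, hcov⟩ := TopologicalSpace.countable_cover_nhdsWithin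
    (fun x hx => (mem_nhdsWithin_of_mem_nhds (hV x hx) : V x ∈ 𝓝[O] x))
  calc dimH (g '' O) ≤ dimH (⋃ x ∈ t, g '' V x) := by
        refine dimH_mono ?_
        rw [← Set.image_iUnion₂]
        exact Set.image_mono hcov
    _ = ⨆ x ∈ t, dimH (g '' V x) := dimH_bUnion htc _
    _ ≤ _ := iSup₂_le fun x hx => hdim x (htO hx)

section Leaves

/-- The fibres are connected, being leaves. -/
theorem IsLeafSpaceProjection.isPreconnected_fibre {E : Type*} [NormedAddCommGroup E]
    [NormedSpace ℝ E] {Q : Type u} [TopologicalSpace Q] [ChartedSpace E Q] {N : Type*}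
    {D : ∀ q : Q, Submodule ℝ (TangentSpace 𝓘(ℝ, E) q)} {π : Q → N}
    (h : IsLeafSpaceProjection (E := E) D π)
    (y : N) : IsPreconnected (π ⁻¹' {y}) := by
  obtain ⟨d, L, _, _, j, _, _, _, _, imm, -, rng, -⟩ := ((h.isLeaf_iff (π ⁻¹' {y})).2 ⟨y, rfl⟩).prop
  rw [← rng]
  exact isPreconnected_range imm.contMDiff.continuous

variable {EQ : Type*} [NormedAddCommGroup EQ] [NormedSpace ℝ EQ] [FiniteDimensional ℝ EQ]
  {Q : Type u} [TopologicalSpace Q] [ChartedSpace EQ Q]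
  {EN : Type*} [NormedAddCommGroup EN] [NormedSpace ℝ EN]
  {N : Type*} [TopologicalSpace N] [ChartedSpace EN N]
  {D : ∀ q : Q, Submodule ℝ (TangentSpace 𝓘(ℝ, EQ) q)} {π : Q → N}

/-- If the fibres of a submersion are the leaves of `D`, then `D` is its vertical distribution.
Since leaves are only injectively immersed, the inclusion of the vertical vectors in `D` is a matter
of dimension: a leaf, being second countable, can only fill a fibre of its own dimension. -/
theorem IsLeafSpaceProjection.eq_ker (h : IsLeafSpaceProjection (E := EQ) D π)
    (hπ : Manifold.IsSubmersion 𝓘(ℝ, EQ) 𝓘(ℝ, EN) ∞ π) (q : Q) :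
    D q = (mfderiv 𝓘(ℝ, EQ) 𝓘(ℝ, EN) π q).ker := by
  obtain ⟨d, L, _, _, j, _, _, _, _, imm, -, rng, rk⟩ :=
    ((h.isLeaf_iff (π ⁻¹' {π q})).2 ⟨π q, rfl⟩).prop
  obtain ⟨K, _, _, _, c, hq⟩ := exists_submersionChart hπ q
  have hπd : ∀ q, MDifferentiableAt 𝓘(ℝ, EQ) 𝓘(ℝ, EN) π q := fun q =>
    hπ.contMDiff.contMDiffAt.mdifferentiableAt (by simp)
  have hjx : ∀ x, π (j x) = π q := fun x => by
    have : j x ∈ π ⁻¹' {π q} := rng ▸ Set.mem_range_self x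
    exact this
  have hsmooth : ∀ x ∈ j ⁻¹' c.dom.source,
      ContMDiffAt 𝓘(ℝ, EuclideanSpace ℝ (Fin d)) 𝓘(ℝ, K) 1 (fun x => (c.dom (j x)).2) x := by
    intro x hx
    have h1 : ContMDiffAt 𝓘(ℝ, EQ) 𝓘(ℝ, EN × K) ∞ c.dom (j x) :=
      c.contMDiffOn_dom.contMDiffAt (c.dom.open_source.mem_nhds hx)
    have h2 : ContMDiffAt 𝓘(ℝ, EN × K) 𝓘(ℝ, K) ∞ (Prod.snd : EN × K → K) (c.dom (j x)) :=
      contDiffAt_snd.contMDiffAt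
    exact ((h2.comp _ h1).comp x imm.contMDiff.contMDiffAt).of_le (by simp)
  -- in the chart, the leaf contains the slice through `q`: its second coordinate fills an open set
  have hfill : (fun x => (c.dom (j x)).2) '' (j ⁻¹' c.dom.source) ∈ 𝓝 (c.dom q).2 := by
    have hcont : ContinuousAt (fun k : K => ((c.dom q).1, k)) (c.dom q).2 := by fun_prop
    filter_upwards [hcont.preimage_mem_nhds (c.dom.open_target.mem_nhds (c.dom.map_source hq))]
      with k hk
    have hπk : π (c.dom.symm ((c.dom q).1, k)) = π q := by
      rw [c.apply_dom_symm hk, c.fst_dom q hq, c.cod.left_inv (c.map_source q hq)]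
    have hmem : c.dom.symm ((c.dom q).1, k) ∈ Set.range j := rng ▸ hπk
    obtain ⟨x, hx⟩ := hmem
    refine ⟨x, ?_, ?_⟩
    · rw [Set.mem_preimage, hx]; exact c.dom.map_target hk
    · simp only [hx, c.dom.right_inv hk]
  have hKd : Module.finrank ℝ K ≤ d := by
    have h1 := dimH_image_le_finrank hsmooth
    rw [Real.dimH_of_mem_nhds hfill, finrank_euclideanSpace_fin] at h1
    exact_mod_cast h1
  obtain ⟨x, rfl⟩ : q ∈ Set.range j := rng ▸ rfl
  have : FiniteDimensional ℝ (TangentSpace 𝓘(ℝ, EQ) (j x)) :=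
    inferInstanceAs (FiniteDimensional ℝ EQ)
  refine Submodule.eq_of_le_of_finrank_le ?_ ?_
  · rw [← rk x]
    rintro _ ⟨v, rfl⟩
    have h1 := mfderiv_comp x (hπd (j x))
      (imm.contMDiff.contMDiffAt.mdifferentiableAt (by simp))
    have h2 : π ∘ j = fun _ => π (j x) := funext hjx
    rw [h2, mfderiv_const] at h1
    exact (DFunLike.congr_fun h1 v).symm
  · refine (c.finrank_ker_le hq (hπd _)).trans (hKd.trans ?_)
    rw [← rk x]
    have h1 := LinearMap.finrank_range_of_inj
      (f := (mfderiv 𝓘(ℝ, EuclideanSpace ℝ (Fin d)) 𝓘(ℝ, EQ) j x :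
        EuclideanSpace ℝ (Fin d) →L[ℝ] EQ).toLinearMap)
      (mfderiv_injective_of_isImmersion imm x)
    exact ((finrank_euclideanSpace_fin (𝕜 := ℝ) (n := d)).symm.trans h1.symm).le

end Leaves

/-! ### Vertical vector fields and contractions of forms -/

section Vertical

variable {EQ : Type u} [NormedAddCommGroup EQ] [NormedSpace ℝ EQ] [FiniteDimensional ℝ EQ]
  {Q : Type*} [TopologicalSpace Q] [ChartedSpace EQ Q] [IsManifold 𝓘(ℝ, EQ) ∞ Q] [T2Space Q]
  {EN : Type*} [NormedAddCommGroup EN] [NormedSpace ℝ EN]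
  {N : Type*} [TopologicalSpace N] [ChartedSpace EN N]

/-- Every vertical vector extends to a global vertical vector field: in submersion charts take a
constant vector field, and cut it off by a bump function. -/
theorem exists_vertical_section {π : Q → N}
    (hπ : Manifold.IsSubmersion 𝓘(ℝ, EQ) 𝓘(ℝ, EN) ∞ π) (q : Q) (v : TangentSpace 𝓘(ℝ, EQ) q)
    (hv : mfderiv 𝓘(ℝ, EQ) 𝓘(ℝ, EN) π q v = 0) :
    ∃ X : ∀ q : Q, TangentSpace 𝓘(ℝ, EQ) q,
      ContMDiff 𝓘(ℝ, EQ) 𝓘(ℝ, EQ).tangent ∞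
        (fun q => (⟨q, X q⟩ : TangentBundle 𝓘(ℝ, EQ) Q)) ∧
      (∀ q, mfderiv 𝓘(ℝ, EQ) 𝓘(ℝ, EN) π q (X q) = 0) ∧ X q = v := by
  obtain ⟨K, _, _, _, c, hq⟩ := exists_submersionChart hπ q
  have hπd : ∀ q, MDifferentiableAt 𝓘(ℝ, EQ) 𝓘(ℝ, EN) π q := fun q =>
    hπ.contMDiff.contMDiffAt.mdifferentiableAt (by simp)
  set κ : EN × K := (0, (mfderiv 𝓘(ℝ, EQ) 𝓘(ℝ, EN × K) c.dom q v : EN × K).2)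
  let Y : ∀ q : Q, TangentSpace 𝓘(ℝ, EQ) q := fun q =>
    mfderiv 𝓘(ℝ, EN × K) 𝓘(ℝ, EQ) c.dom.symm (c.dom q) κ
  have hYv : Y q = v := (c.exists_of_mfderiv_eq_zero hq (hπd q) v hv).symm
  have hYπ : ∀ p ∈ c.dom.source, mfderiv 𝓘(ℝ, EQ) 𝓘(ℝ, EN) π p (Y p) = 0 := by
    intro p hp
    have h := c.mfderiv_comp_dom_symm (c.dom.map_source hp) (hπd _) κ
    rw [c.dom.left_inv hp] at h
    exact h.trans (map_zero _)
  have : IsManifold 𝓘(ℝ, EQ) 1 Q := .of_le (n := ∞) (by simp)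
  have hY : ContMDiffOn 𝓘(ℝ, EQ) 𝓘(ℝ, EQ).tangent ∞
      (fun q => (⟨q, Y q⟩ : TangentBundle 𝓘(ℝ, EQ) Q)) c.dom.source := by
    have h1 := c.contMDiffOn_dom_symm.contMDiffOn_tangentMapWithin (m := ∞) (by simp)
      c.dom.open_target.uniqueMDiffOn
    have hconst : ContMDiff 𝓘(ℝ, EN × K) 𝓘(ℝ, EN × K).tangent ∞
        (fun z => (⟨z, κ⟩ : TangentBundle 𝓘(ℝ, EN × K) (EN × K))) := fun z =>
      contMDiffWithinAt_vectorSpace_iff_contDiffWithinAt.2 contDiffWithinAt_const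
    have h2 := h1.comp (hconst.comp_contMDiffOn c.contMDiffOn_dom) (fun p hp => c.dom.map_source hp)
    refine h2.congr fun p hp => ?_
    have key : ∀ (a : Q) (w : EQ), p = a →
        (⟨p, w⟩ : TangentBundle 𝓘(ℝ, EQ) Q) = ⟨a, w⟩ := by
      rintro a w rfl
      rfl
    -- the composition lives over `c.dom.symm (c.dom p)`, which is `p` only propositionally
    refine (key _ _ (c.dom.left_inv hp).symm).trans ?_
    simp only [tangentMapWithin, Function.comp_apply,
      mfderivWithin_of_isOpen c.dom.open_target (c.dom.map_source hp)]
    rfl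
  obtain ⟨ρ, -, hρ⟩ := (SmoothBumpFunction.nhds_basis_tsupport (I := 𝓘(ℝ, EQ)) q).mem_iff.1
    (c.dom.open_source.mem_nhds hq)
  refine ⟨(ρ : Q → ℝ) • Y, ContMDiffOn.smul_section_of_tsupport ρ.contMDiff.contMDiffOn
    c.dom.open_source hρ hY, fun p => ?_, ?_⟩
  · by_cases hp : p ∈ c.dom.source
    · simp only [Pi.smul_apply', map_smul, hYπ p hp, smul_zero]
    · have : ρ p = 0 := by
        by_contra h
        exact hp (hρ (subset_tsupport _ h))
      simp only [Pi.smul_apply', this, zero_smul, map_zero]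
  · simp [hYv]

end Vertical

section Forms

variable {E : Type*} [NormedAddCommGroup E] [NormedSpace ℝ E]
  {M : Type*} [TopologicalSpace M] [ChartedSpace E M]
  {E' : Type*} [NormedAddCommGroup E'] [NormedSpace ℝ E']
  {M' : Type*} [TopologicalSpace M'] [ChartedSpace E' M']

theorem comp_apply_one (β : E' [⋀^Fin 1]→L[ℝ] ℝ) (A : E →L[ℝ] E') (v : E) :
    β.compContinuousLinearMap A ![v] = β ![A v] := by
  rw [ContinuousAlternatingMap.compContinuousLinearMap_apply]
  congr 1
  ext i
  fin_cases i
  rfl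

theorem comp_apply_two (β : E' [⋀^Fin 2]→L[ℝ] ℝ) (A : E →L[ℝ] E') (v w : E) :
    β.compContinuousLinearMap A ![v, w] = β ![A v, A w] := by
  rw [ContinuousAlternatingMap.compContinuousLinearMap_apply]
  congr 1
  ext i
  fin_cases i <;> rfl

theorem comp_apply_three (β : E' [⋀^Fin 3]→L[ℝ] ℝ) (A : E →L[ℝ] E') (v w z : E) :
    β.compContinuousLinearMap A ![v, w, z] = β ![A v, A w, A z] := by
  rw [ContinuousAlternatingMap.compContinuousLinearMap_apply]
  congr 1
  ext i
  fin_cases i <;> rfl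

theorem apply_two_swap (β : E [⋀^Fin 2]→L[ℝ] ℝ) (v w : E) : β ![v, w] = - β ![w, v] := by
  have h := β.toAlternatingMap.map_swap ![w, v] (i := 0) (j := 1) (by decide)
  have hs : (![w, v] ∘ Equiv.swap (0 : Fin 2) 1) = ![v, w] := by
    ext i
    fin_cases i <;> simp
  rw [hs] at h
  exact h

theorem ext_two {β γ : E [⋀^Fin 2]→L[ℝ] ℝ} (h : ∀ v w, β ![v, w] = γ ![v, w]) : β = γ := by
  ext x
  have : x = ![x 0, x 1] := by
    ext i
    fin_cases i <;> rfl
  rw [this]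
  exact h _ _

theorem pullback_apply_two (f : M → M') (θ : DiffForm E' M' 2) (x : M) (v w : E) :
    (pullback (E := E) f θ x : E [⋀^Fin 2]→L[ℝ] ℝ) ![v, w] =
      (θ (f x) : E' [⋀^Fin 2]→L[ℝ] ℝ)
        ![mfderiv 𝓘(ℝ, E) 𝓘(ℝ, E') f x v, mfderiv 𝓘(ℝ, E) 𝓘(ℝ, E') f x w] :=
  comp_apply_two (E := E) (E' := E') (θ (f x)) (mfderiv 𝓘(ℝ, E) 𝓘(ℝ, E') f x) v w

/-- The characteristic distribution of `ι` is the kernel of `ι^*Ω`. -/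
theorem mem_charDistribution (Ω : DiffForm E' M' 2) (ι : M → M') (q : M)
    (v : TangentSpace 𝓘(ℝ, E) q) :
    v ∈ charDistribution (EQ := E) Ω ι q ↔ ∀ w : E, pullback (E := E) ι Ω q ![v, w] = 0 := by
  have h : ∀ w : E, pullback (E := E) ι Ω q ![v, w] =
      Ω (ι q) ![mfderiv 𝓘(ℝ, E) 𝓘(ℝ, E') ι q v, mfderiv 𝓘(ℝ, E) 𝓘(ℝ, E') ι q w] := fun w =>
    pullback_apply_two (E := E) (E' := E') ι Ω q v w
  constructor
  · intro hv w
    rw [h]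
    exact hv _ ⟨w, rfl⟩
  · rintro hv _ ⟨w, rfl⟩
    exact (h w).symm.trans (hv w)

/-- Leibniz rule for the product of a function and a `2`-form, contracted with a vector that is
annihilated by the form and by the differential of the function. -/
theorem extD_smulForm_apply [IsManifold 𝓘(ℝ, E) ∞ M] {g : M → ℝ} {θ : DiffForm E M 2}
    (hθ : SmoothFormOn θ Set.univ) {x : M} (hg : ContMDiffAt 𝓘(ℝ, E) 𝓘(ℝ, ℝ) ∞ g x) {v : E}
    (hgv : mfderiv 𝓘(ℝ, E) 𝓘(ℝ, ℝ) g x v = 0) (hv : ∀ w : E, θ x ![v, w] = 0) (a b : E) :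
    extD (smulForm g θ) x ![v, a, b] = g x * extD θ x ![v, a, b] := by
  set c := extChartAt 𝓘(ℝ, E) x
  have hcx : c.symm (c x) = x := by simp [c]
  have hsymm : ContMDiffAt 𝓘(ℝ, E) 𝓘(ℝ, E) ∞ c.symm (c x) :=
    (contMDiffOn_extChartAt_symm x).contMDiffAt (extChartAt_target_mem_nhds x)
  have hgc : ContMDiffAt 𝓘(ℝ, E) 𝓘(ℝ, ℝ) ∞ (g ∘ c.symm) (c x) := by
    refine ContMDiffAt.comp _ ?_ hsymm
    rwa [hcx]
  have hθd : DifferentiableAt ℝ (inChart θ x) (c x) :=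
    ((hθ x).contDiffAt (Filter.inter_mem (extChartAt_target_mem_nhds x)
      Filter.univ_mem)).differentiableAt (by simp)
  have hgd : DifferentiableAt ℝ (g ∘ c.symm) (c x) := hgc.contDiffAt.differentiableAt (by simp)
  have hprod : extDeriv (inChart (smulForm g θ) x) (c x) =
      g x • extDeriv (inChart θ x) (c x) +
        wedgeOne (ContinuousAlternatingMap.ofSubsingleton ℝ E ℝ (0 : Fin 1)
          (fderiv ℝ (g ∘ c.symm) (c x))) (inChart θ x (c x)) := by
    have e : inChart (smulForm g θ) x = fun y => (g ∘ c.symm) y • inChart θ x y := rfl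
    rw [e, extDeriv, fderiv_fun_smul hgd hθd, ContinuousAlternatingMap.alternatizeUncurryFin_add,
      ContinuousAlternatingMap.alternatizeUncurryFin_smul, wedgeOne, Equiv.symm_apply_apply,
      Function.comp_apply, hcx]
    rfl
  have hcd : MDifferentiableAt 𝓘(ℝ, E) 𝓘(ℝ, E) c x :=
    (contMDiffAt_extChartAt (n := ∞) (x := x) (I := 𝓘(ℝ, E))).mdifferentiableAt (by simp)
  let A : E →L[ℝ] E := mfderiv 𝓘(ℝ, E) 𝓘(ℝ, E) c x
  have hgA : fderiv ℝ (g ∘ c.symm) (c x) (A v) = 0 := by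
    have h1 := mfderiv_comp x (hgc.mdifferentiableAt (by simp)) hcd
    have e : (g ∘ c.symm) ∘ c =ᶠ[𝓝 x] g := by
      filter_upwards [extChartAt_source_mem_nhds (I := 𝓘(ℝ, E)) x] with z hz
      simp only [Function.comp_apply]
      rw [c.left_inv hz]
    have h2 := DFunLike.congr_fun (h1.symm.trans e.mfderiv_eq) v
    rw [mfderiv_eq_fderiv] at h2
    exact h2.trans hgv
  let β : E [⋀^Fin 2]→L[ℝ] ℝ := θ x
  have hβ : ∀ w : E, β ![v, w] = 0 := hv
  have hin : ∀ w z : E, inChart θ x (c x) ![A w, A z] = β ![w, z] := by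
    intro w z
    have e : c.symm ∘ c =ᶠ[𝓝 x] id := by
      filter_upwards [extChartAt_source_mem_nhds (I := 𝓘(ℝ, E)) x] with z hz using c.left_inv hz
    have h1 := (pullback_comp (f := c) (g := c.symm) θ (hsymm.mdifferentiableAt (by simp))
      hcd).symm.trans ((pullback_congr θ e).trans (pullback_id θ x))
    refine Eq.trans ?_ (congrArg (fun γ : E [⋀^Fin 2]→L[ℝ] ℝ => γ ![w, z]) h1)
    exact (pullback_apply_two c (inChart θ x) x w z).symm
  have h0 : ∀ β : E [⋀^Fin 3]→L[ℝ] ℝ, (β.compContinuousLinearMap A) ![v, a, b] =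
      β ![A v, A a, A b] := fun β => comp_apply_three (E := E) (E' := E) β A v a b
  change ((extDeriv (inChart (smulForm g θ) x) (c x)).compContinuousLinearMap A) ![v, a, b] =
    g x * ((extDeriv (inChart θ x) (c x)).compContinuousLinearMap A) ![v, a, b]
  refine (h0 _).trans (Eq.trans ?_ (congrArg (g x * ·) (h0 _).symm))
  rw [hprod, ContinuousAlternatingMap.add_apply, wedgeOne_apply, hin, hin, hin,
    apply_two_swap β b v, hβ, hβ]
  simp [hgA]

end Forms

/-! ### Descent of forms along a submersion -/

section Forms

variable {E : Type*} [NormedAddCommGroup E] [NormedSpace ℝ E]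
  {M : Type*} [TopologicalSpace M] [ChartedSpace E M] [IsManifold 𝓘(ℝ, E) ∞ M]
  {E' : Type*} [NormedAddCommGroup E'] [NormedSpace ℝ E']
  {M' : Type*} [TopologicalSpace M'] [ChartedSpace E' M'] [IsManifold 𝓘(ℝ, E') ∞ M']

theorem SmoothFormOn.pullback {k : ℕ} {θ : DiffForm E' M' k} (hθ : SmoothFormOn θ Set.univ)
    {f : M → M'} (hf : ContMDiff 𝓘(ℝ, E) 𝓘(ℝ, E') ∞ f) :
    SmoothFormOn (LCSReduction.pullback (E := E) f θ) Set.univ :=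
  smoothFormOn_of_pullback isOpen_univ hθ fun _ _ =>
    ⟨trivial, hf.contMDiffAt, Filter.Eventually.of_forall fun _ => rfl⟩

/-- Contracting `dΩ = η ∧ Ω`, pulled back along `f`, with a vector in the kernel of `f^*Ω`. -/
theorem extD_pullback_apply_of_lee {Ω : DiffForm E' M' 2} {η : DiffForm E' M' 1}
    (hΩ : SmoothFormOn Ω Set.univ) (hlee : ∀ x, extD Ω x = wedgeOne (V := E') (η x) (Ω x))
    {f : M → M'} (hf : ContMDiff 𝓘(ℝ, E) 𝓘(ℝ, E') ∞ f) {x : M} {v : E}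
    (hv : ∀ w : E, pullback (E := E) f Ω x ![v, w] = 0) (a b : E) :
    extD (pullback (E := E) f Ω) x ![v, a, b] =
      pullback (E := E) f η x ![v] * pullback (E := E) f Ω x ![a, b] := by
  rw [extD_pullback isOpen_univ hΩ trivial hf.contMDiffAt]
  let A : E →L[ℝ] E' := mfderiv 𝓘(ℝ, E) 𝓘(ℝ, E') f x
  let β : E' [⋀^Fin 2]→L[ℝ] ℝ := Ω (f x)
  let α : E' [⋀^Fin 1]→L[ℝ] ℝ := η (f x)
  have h1 : (wedgeOne α β).compContinuousLinearMap A ![v, a, b] =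
      α.compContinuousLinearMap A ![v] * β.compContinuousLinearMap A ![a, b] := by
    have hv' : ∀ w : E, β ![A v, A w] = 0 := fun w => (comp_apply_two β A v w).symm.trans (hv w)
    rw [comp_apply_three, comp_apply_one, comp_apply_two, wedgeOne_apply,
      apply_two_swap β (A b) (A v), hv', hv']
    simp
  refine Eq.trans ?_ h1
  have h2 : (extD Ω (f x) : E' [⋀^Fin 3]→L[ℝ] ℝ) = wedgeOne α β := hlee (f x)
  exact congrArg
    (fun ζ : E' [⋀^Fin 3]→L[ℝ] ℝ => ζ.compContinuousLinearMap A ![v, a, b]) h2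

/-- If `f^*Ω` descends along the submersion `π` to a locally conformal symplectic form `τ`, the
pullback of the Lee form of `Ω` vanishes on the kernel of `f^*Ω`. Indeed `h • τ` is closed near a
given point for a positive function `h`, so `(h ∘ π) • f^*Ω` is closed. Contracting its differential
with a vertical vector `v` leaves `h * (f^*η)(v) • f^*Ω`. -/
theorem lee_eq_zero_of_pullback_eq {Ω : DiffForm E' M' 2} {η : DiffForm E' M' 1}
    (hM : IsLCSManifold Ω η) {f : M → M'} (hf : ContMDiff 𝓘(ℝ, E) 𝓘(ℝ, E') ∞ f)
    [FiniteDimensional ℝ E]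
    {EN : Type*} [NormedAddCommGroup EN] [NormedSpace ℝ EN] [Nontrivial EN]
    {N : Type*} [TopologicalSpace N] [ChartedSpace EN N] [IsManifold 𝓘(ℝ, EN) ∞ N]
    {π : M → N} (hπ : Manifold.IsSubmersion 𝓘(ℝ, E) 𝓘(ℝ, EN) ∞ π)
    {τ : DiffForm EN N 2} (hτ : IsLCSForm τ)
    (h : pullback (E := E) π τ = pullback (E := E) f Ω) {x : M} {v : E}
    (hv : ∀ w : E, pullback (E := E) f Ω x ![v, w] = 0) :
    pullback (E := E) f η x ![v] = 0 := by
  obtain ⟨σ, hσ⟩ := exists_rightInverse_mfderiv hπ x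
  let P : E →L[ℝ] EN := mfderiv 𝓘(ℝ, E) 𝓘(ℝ, EN) π x
  let β : EN [⋀^Fin 2]→L[ℝ] ℝ := τ (π x)
  let γ : E [⋀^Fin 2]→L[ℝ] ℝ := pullback (E := E) f Ω x
  have hσ' : ∀ w, P (σ w) = w := hσ
  have hγ : ∀ a b : E, γ ![a, b] = β ![P a, P b] := fun a b => by
    have h1 : γ = β.compContinuousLinearMap P := (congrFun h x).symm
    rw [h1, comp_apply_two]
  have hPv : P v = 0 := by
    refine hτ.nondegenerate (π x) (P v) fun (w : EN) => ?_
    have h1 := (hγ v (σ w)).symm.trans (hv (σ w))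
    rw [hσ' w] at h1
    exact h1
  obtain ⟨U, hU, hxU, g, hg, hgpos, hsymp⟩ := hτ.locally_conformal (π x)
  have hπx : ContMDiffAt 𝓘(ℝ, E) 𝓘(ℝ, EN) ∞ π x := hπ.contMDiff.contMDiffAt
  have hgx : ContMDiffAt 𝓘(ℝ, EN) 𝓘(ℝ, ℝ) ∞ g (π x) := hg.contMDiffAt (hU.mem_nhds hxU)
  have hclosed : extD (smulForm (g ∘ π) (pullback (E := E) f Ω)) x = 0 := by
    rw [← h, ← pullback_smulForm, extD_pullback hU hsymp.smooth hxU hπx]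
    simp only [pullback]
    rw [hsymp.closed _ hxU]
    rfl
  have hgv : mfderiv 𝓘(ℝ, E) 𝓘(ℝ, ℝ) (g ∘ π) x v = 0 := by
    rw [mfderiv_comp x (hgx.mdifferentiableAt (by simp)) (hπx.mdifferentiableAt (by simp))]
    exact (congrArg (mfderiv 𝓘(ℝ, EN) 𝓘(ℝ, ℝ) g (π x)) hPv).trans (map_zero _)
  have hprod : ∀ a b : E, pullback (E := E) f η x ![v] * γ ![a, b] = 0 := by
    intro a b
    have h1 := extD_smulForm_apply (hM.isLCSForm.smooth.pullback hf) (hgx.comp x hπx) hgv hv a b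
    rw [hclosed, extD_pullback_apply_of_lee hM.isLCSForm.smooth hM.lee_eq hf hv] at h1
    have h2 : (g ∘ π) x ≠ 0 := (hgpos _ hxU).ne'
    exact (mul_eq_zero.1 h1.symm).resolve_left h2
  obtain ⟨w, hw⟩ := exists_ne (0 : EN)
  have hw' : ∃ w', β ![w, w'] ≠ 0 := by
    by_contra! hcon
    exact hw (hτ.nondegenerate (π x) w hcon)
  obtain ⟨w', hw'⟩ := hw'
  have h1 := hprod (σ w) (σ w')
  rw [hγ, hσ', hσ'] at h1
  exact (mul_eq_zero.1 h1).resolve_right hw'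

end Forms

section Descent

variable {EQ : Type*} [NormedAddCommGroup EQ] [NormedSpace ℝ EQ]
  {Q : Type*} [TopologicalSpace Q] [ChartedSpace EQ Q]
  {EN : Type*} [NormedAddCommGroup EN] [NormedSpace ℝ EN]
  {N : Type*} [TopologicalSpace N] [ChartedSpace EN N]

/-- The `2`-covector `β` at `π q` pulls back to the value of `Θ` at `q`. -/
def DescendsAt (π : Q → N) (Θ : DiffForm EQ Q 2) (q : Q) (β : EN [⋀^Fin 2]→L[ℝ] ℝ) : Prop :=
  ∀ a b : EQ, β ![(mfderiv 𝓘(ℝ, EQ) 𝓘(ℝ, EN) π q : EQ →L[ℝ] EN) a,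
    (mfderiv 𝓘(ℝ, EQ) 𝓘(ℝ, EN) π q : EQ →L[ℝ] EN) b] = Θ q ![a, b]

/-- In submersion charts, whether `β` pulls back to `Θ` is read off from the coordinate expression
of `Θ` at `z` and the base coordinate `z.1`. -/
theorem SubmersionChart.descendsAt_iff {π : Q → N} {K : Type*} [NormedAddCommGroup K]
    [NormedSpace ℝ K] (c : SubmersionChart (EQ := EQ) (EN := EN) π K) (Θ : DiffForm EQ Q 2)
    {z : EN × K} (hz : z ∈ c.dom.target)
    (hπ : MDifferentiableAt 𝓘(ℝ, EQ) 𝓘(ℝ, EN) π (c.dom.symm z)) (β : EN [⋀^Fin 2]→L[ℝ] ℝ) :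
    DescendsAt π Θ (c.dom.symm z) β ↔ ∀ v w : EN × K,
      β ![(mfderiv 𝓘(ℝ, EN) 𝓘(ℝ, EN) c.cod.symm z.1 : EN →L[ℝ] EN) v.1,
        (mfderiv 𝓘(ℝ, EN) 𝓘(ℝ, EN) c.cod.symm z.1 : EN →L[ℝ] EN) w.1] =
      pullback (E := EN × K) c.dom.symm Θ z ![v, w] := by
  let A : EN × K →L[ℝ] EQ := mfderiv 𝓘(ℝ, EN × K) 𝓘(ℝ, EQ) c.dom.symm z
  let P : EQ →L[ℝ] EN := mfderiv 𝓘(ℝ, EQ) 𝓘(ℝ, EN) π (c.dom.symm z)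
  let R : EN →L[ℝ] EN := mfderiv 𝓘(ℝ, EN) 𝓘(ℝ, EN) c.cod.symm z.1
  let θ : EQ [⋀^Fin 2]→L[ℝ] ℝ := Θ (c.dom.symm z)
  have hPA : ∀ v, P (A v) = R v.1 := c.mfderiv_comp_dom_symm hz hπ
  have hA : Function.Surjective A := (c.mdifferentiable_dom.symm.mfderiv_surjective hz)
  change (∀ a b : EQ, β ![P a, P b] = θ ![a, b]) ↔
    ∀ v w : EN × K, β ![R v.1, R w.1] = θ.compContinuousLinearMap A ![v, w]
  simp only [← hPA, comp_apply_two]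
  refine ⟨fun h v w => h _ _, fun h a b => ?_⟩
  obtain ⟨v, rfl⟩ := hA a
  obtain ⟨w, rfl⟩ := hA b
  exact h v w

/-- A form annihilated by a constant vector `κ` and whose exterior derivative is annihilated by `κ`
at `z` has vanishing derivative at `z` in the direction `κ`. -/
theorem fderiv_eq_zero_of_extDeriv {W : Type*} [NormedAddCommGroup W] [NormedSpace ℝ W]
    {F : W → W [⋀^Fin 2]→L[ℝ] ℝ} {z κ : W} (hF : DifferentiableAt ℝ F z)
    (h1 : ∀ᶠ z' in 𝓝 z, ∀ w, F z' ![κ, w] = 0) (h2 : ∀ a b, extDeriv F z ![κ, a, b] = 0) :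
    fderiv ℝ F z κ = 0 := by
  refine ext_two fun a b => ?_
  have h := h2 a b
  rw [extDeriv_apply hF, Fin.sum_univ_three] at h
  have e0 : (0 : Fin 3).removeNth ![κ, a, b] = ![a, b] := by
    ext i
    fin_cases i <;> rfl
  have e1 : (1 : Fin 3).removeNth ![κ, a, b] = ![κ, b] := by
    ext i
    fin_cases i <;> rfl
  have e2 : (2 : Fin 3).removeNth ![κ, a, b] = ![κ, a] := by
    ext i
    fin_cases i <;> rfl
  have hz : ∀ w, fderiv ℝ (fun z' => F z' ![κ, w]) z = 0 := fun w => by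
    have : (fun z' => F z' ![κ, w]) =ᶠ[𝓝 z] fun _ => 0 := h1.mono fun z' hz' => hz' w
    rw [this.fderiv_eq]
    simp
  rw [e0, e1, e2, hz, hz] at h
  simp only [Fin.val_zero, pow_zero, one_smul, Matrix.cons_val_zero, zero_apply,
    smul_zero, add_zero] at h
  rw [fderiv_continuousAlternatingMap_apply_const_apply hF] at h
  simpa using h

variable [FiniteDimensional ℝ EQ] [IsManifold 𝓘(ℝ, EQ) ∞ Q] {π : Q → N} {Θ : DiffForm EQ Q 2}

/-- A form annihilated, together with its differential, by the vertical vectors is locally constant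
along the fibres. -/
theorem eventually_descendsAt_iff (hπ : Manifold.IsSubmersion 𝓘(ℝ, EQ) 𝓘(ℝ, EN) ∞ π)
    (hΘ : SmoothFormOn Θ Set.univ)
    (hker : ∀ (q : Q) (v : EQ), mfderiv 𝓘(ℝ, EQ) 𝓘(ℝ, EN) π q v = 0 → ∀ w : EQ, Θ q ![v, w] = 0)
    (hd : ∀ (q : Q) (v : EQ), mfderiv 𝓘(ℝ, EQ) 𝓘(ℝ, EN) π q v = 0 →
      ∀ a b : EQ, extD Θ q ![v, a, b] = 0) (q : Q) :
    ∀ᶠ q' in 𝓝 q, π q' = π q → ∀ β : EN [⋀^Fin 2]→L[ℝ] ℝ,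
      (DescendsAt π Θ q' β ↔ DescendsAt π Θ q β) := by
  obtain ⟨K, _, _, _, c, hq⟩ := exists_submersionChart hπ q
  have hπd : ∀ q, MDifferentiableAt 𝓘(ℝ, EQ) 𝓘(ℝ, EN) π q := fun q =>
    hπ.contMDiff.contMDiffAt.mdifferentiableAt (by simp)
  let F : EN × K → (EN × K) [⋀^Fin 2]→L[ℝ] ℝ := pullback (E := EN × K) c.dom.symm Θ
  have hFdiff : ∀ z ∈ c.dom.target, DifferentiableAt ℝ F z := fun z hz =>
    (contDiffAt_pullback isOpen_univ hΘ trivial (c.contMDiffAt_dom_symm hz)).differentiableAt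
      (by simp)
  have hvert : ∀ z ∈ c.dom.target, ∀ κ : K, mfderiv 𝓘(ℝ, EQ) 𝓘(ℝ, EN) π (c.dom.symm z)
      (mfderiv 𝓘(ℝ, EN × K) 𝓘(ℝ, EQ) c.dom.symm z ((0, κ) : EN × K)) = 0 := fun z hz κ =>
    (c.mfderiv_comp_dom_symm hz (hπd _) (0, κ)).trans (map_zero _)
  have hFκ : ∀ z ∈ c.dom.target, ∀ κ : K, ∀ w, F z ![(0, κ), w] = 0 := fun z hz κ w =>
    (pullback_apply_two c.dom.symm Θ z (0, κ) w).trans (hker _ _ (hvert z hz κ) _)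
  have hdF : ∀ z ∈ c.dom.target, ∀ κ : K, fderiv ℝ F z (0, κ) = 0 := by
    intro z hz κ
    refine fderiv_eq_zero_of_extDeriv (hFdiff z hz) ?_ fun a b => ?_
    · filter_upwards [c.dom.open_target.mem_nhds hz] with z' hz' using hFκ z' hz' κ
    · have h1 : extDeriv F z = pullback (E := EN × K) c.dom.symm (extD Θ) z :=
        (extD_eq_extDeriv _ z).symm.trans
          (extD_pullback isOpen_univ hΘ trivial (c.contMDiffAt_dom_symm hz))
      rw [h1]
      exact (comp_apply_three (E := EN × K) (E' := EQ) (extD Θ (c.dom.symm z))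
        (mfderiv 𝓘(ℝ, EN × K) 𝓘(ℝ, EQ) c.dom.symm z) (0, κ) a b).trans
        (hd _ _ (hvert z hz κ) _ _)
  have hcont : ContinuousAt (fun k : K => ((c.dom q).1, k)) (c.dom q).2 := by fun_prop
  obtain ⟨ε, hε, hball⟩ := Metric.mem_nhds_iff.1
    (hcont.preimage_mem_nhds (c.dom.open_target.mem_nhds (c.dom.map_source hq)))
  have hconst : ∀ k ∈ Metric.ball (c.dom q).2 ε, F ((c.dom q).1, k) = F (c.dom q) := by
    intro k hk
    have hder : ∀ k ∈ Metric.ball (c.dom q).2 ε,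
        HasFDerivAt (fun k => F ((c.dom q).1, k)) (0 : K →L[ℝ] _) k := by
      intro k hk
      have h1 := (hFdiff _ (hball hk)).hasFDerivAt.comp k
        (hasFDerivAt_prodMk_right (𝕜 := ℝ) (c.dom q).1 k)
      have h2 : (fderiv ℝ F ((c.dom q).1, k)).comp (ContinuousLinearMap.inr ℝ EN K) = 0 := by
        ext1 κ
        exact hdF _ (hball hk) κ
      rw [h2] at h1
      exact h1
    exact Metric.isOpen_ball.is_const_of_fderiv_eq_zero
      (convex_ball _ _).isPreconnected
      (fun k hk => (hder k hk).differentiableAt.differentiableWithinAt)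
      (fun k hk => (hder k hk).fderiv) hk (Metric.mem_ball_self hε)
  have hsnd : ∀ᶠ q' in 𝓝 q, (c.dom q').2 ∈ Metric.ball (c.dom q).2 ε :=
    (continuous_snd.continuousAt.comp (c.dom.continuousAt hq)).preimage_mem_nhds
      (Metric.ball_mem_nhds _ hε)
  filter_upwards [c.dom.open_source.mem_nhds hq, hsnd] with q' hq' hk hπq β
  have hfst : (c.dom q').1 = (c.dom q).1 := by rw [c.fst_dom _ hq', c.fst_dom _ hq, hπq]
  have hF : F (c.dom q') = F (c.dom q) := by
    rw [← hconst _ hk, ← hfst]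
  have h1 := c.descendsAt_iff Θ (c.dom.map_source hq) (hπd _) β
  have h2 := c.descendsAt_iff Θ (c.dom.map_source hq') (hπd _) β
  rw [c.dom.left_inv hq] at h1
  rw [c.dom.left_inv hq', hfst] at h2
  rw [h1, h2]
  change (∀ v w, _ = F (c.dom q') ![v, w]) ↔ (∀ v w, _ = F (c.dom q) ![v, w])
  rw [hF]

/-- A form annihilated, together with its differential, by the vertical vectors of a submersion with
connected fibres is a pullback from the base. -/
theorem exists_pullback_eq (hπ : Manifold.IsSubmersion 𝓘(ℝ, EQ) 𝓘(ℝ, EN) ∞ π)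
    (hsurj : Function.Surjective π) (hconn : ∀ y, IsPreconnected (π ⁻¹' {y}))
    (hΘ : SmoothFormOn Θ Set.univ)
    (hker : ∀ (q : Q) (v : EQ), mfderiv 𝓘(ℝ, EQ) 𝓘(ℝ, EN) π q v = 0 → ∀ w : EQ, Θ q ![v, w] = 0)
    (hd : ∀ (q : Q) (v : EQ), mfderiv 𝓘(ℝ, EQ) 𝓘(ℝ, EN) π q v = 0 →
      ∀ a b : EQ, extD Θ q ![v, a, b] = 0) :
    ∃ τ : DiffForm EN N 2, pullback (E := EQ) π τ = Θ := by
  have hex : ∀ q, ∃ β : EN [⋀^Fin 2]→L[ℝ] ℝ, DescendsAt π Θ q β := by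
    intro q
    obtain ⟨σ, hσ⟩ := exists_rightInverse_mfderiv hπ q
    let P : EQ →L[ℝ] EN := mfderiv 𝓘(ℝ, EQ) 𝓘(ℝ, EN) π q
    let θ : EQ [⋀^Fin 2]→L[ℝ] ℝ := Θ q
    have hσ' : ∀ w, P (σ w) = w := hσ
    have hθ : ∀ a b, θ ![σ (P a), b] = θ ![a, b] := by
      intro a b
      have h1 : θ ![σ (P a) - a, b] = 0 := hker q _ (by
        have : P (σ (P a) - a) = 0 := by rw [map_sub, hσ', sub_self]
        exact this) b
      have h2 := θ.toAlternatingMap.map_vecCons_add ![b] (σ (P a) - a) a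
      rw [sub_add_cancel] at h2
      exact h2.trans (by change θ ![_, b] + θ ![a, b] = _; rw [h1, zero_add])
    -- lift vectors along `σ`: `σ (P a)` and `a` differ by a vertical vector, which `Θ` does not see
    refine ⟨θ.compContinuousLinearMap σ, fun a b => ?_⟩
    refine (comp_apply_two θ σ (P a) (P b)).trans ?_
    rw [hθ, apply_two_swap, hθ, ← apply_two_swap]
    rfl
  have hfib : ∀ y, ∃ β : EN [⋀^Fin 2]→L[ℝ] ℝ, ∀ q, π q = y → DescendsAt π Θ q β := by
    intro y
    obtain ⟨q₀, hq₀⟩ := hsurj y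
    obtain ⟨β, hβ⟩ := hex q₀
    refine ⟨β, fun q hq => ?_⟩
    have hloc : ∀ x ∈ π ⁻¹' {y}, ∀ᶠ x' in 𝓝[π ⁻¹' {y}] x,
        (DescendsAt π Θ x β ↔ DescendsAt π Θ x' β) := by
      intro x hx
      filter_upwards [mem_nhdsWithin_of_mem_nhds (eventually_descendsAt_iff hπ hΘ hker hd x),
        self_mem_nhdsWithin] with x' h1 h2
      exact (h1 (h2.trans hx.symm) β).symm
    have := (hconn y).induction₂ (fun x x' => (DescendsAt π Θ x β ↔ DescendsAt π Θ x' β)) hloc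
      (fun _ _ _ _ _ _ h h' => h.trans h') (fun _ _ _ _ h => h.symm) hq₀ hq
    exact this.1 hβ
  choose τ hτ using hfib
  refine ⟨τ, funext fun q => ?_⟩
  refine ext_two (E := EQ) fun a b => ?_
  exact (pullback_apply_two π τ q a b).trans (hτ (π q) q rfl a b)

end Descent

/-! ### Locally conformal symplectic forms on the base -/

theorem smoothFormOn_of_locally {E : Type*} [NormedAddCommGroup E] [NormedSpace ℝ E]
    {M : Type*} [TopologicalSpace M] [ChartedSpace E M] {k : ℕ} {θ : DiffForm E M k}
    (h : ∀ x, ∃ U : Set M, x ∈ U ∧ IsOpen U ∧ SmoothFormOn θ U) :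
    SmoothFormOn θ Set.univ := by
  rintro x₀ y ⟨hy, -⟩
  obtain ⟨U, hxU, hU, hθ⟩ := h ((extChartAt 𝓘(ℝ, E) x₀).symm y)
  refine ContDiffAt.contDiffWithinAt ((hθ x₀).contDiffAt ?_)
  have hsymm : ContinuousAt (extChartAt 𝓘(ℝ, E) x₀).symm y :=
    (continuousOn_extChartAt_symm x₀).continuousAt ((isOpen_extChartAt_target x₀).mem_nhds hy)
  exact Filter.inter_mem ((isOpen_extChartAt_target x₀).mem_nhds hy)
    (hsymm.preimage_mem_nhds (hU.mem_nhds hxU))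

section Base

variable {E : Type*} [NormedAddCommGroup E] [NormedSpace ℝ E]
  {M : Type*} [TopologicalSpace M] [ChartedSpace E M] [IsManifold 𝓘(ℝ, E) ∞ M]
  {EQ : Type*} [NormedAddCommGroup EQ] [NormedSpace ℝ EQ] [FiniteDimensional ℝ EQ]
  {Q : Type*} [TopologicalSpace Q] [ChartedSpace EQ Q]
  {EN : Type*} [NormedAddCommGroup EN] [NormedSpace ℝ EN]
  {N : Type*} [TopologicalSpace N] [ChartedSpace EN N] [IsManifold 𝓘(ℝ, EN) ∞ N]

/-- A form on the base of a submersion `π` whose pullback is `f^*Ω`, for a locally conformal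
symplectic form `Ω`, is locally conformal symplectic if the kernel of `f^*Ω` is vertical: it is
locally the pullback of `Ω` along `f ∘ s`, for local sections `s` of `π`. -/
theorem isLCSForm_of_pullback_eq {Ω : DiffForm E M 2} (hΩ : IsLCSForm Ω) {f : Q → M}
    (hf : ContMDiff 𝓘(ℝ, EQ) 𝓘(ℝ, E) ∞ f) {π : Q → N}
    (hπ : Manifold.IsSubmersion 𝓘(ℝ, EQ) 𝓘(ℝ, EN) ∞ π) (hsurj : Function.Surjective π)
    {τ : DiffForm EN N 2} (h : pullback (E := EQ) π τ = pullback (E := EQ) f Ω)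
    (hker : ∀ (q : Q) (v : EQ), (∀ w : EQ, pullback (E := EQ) f Ω q ![v, w] = 0) →
      mfderiv 𝓘(ℝ, EQ) 𝓘(ℝ, EN) π q v = 0) :
    IsLCSForm τ := by
  have hnondeg : ∀ y, NondegenerateAt τ y := by
    intro y v hv
    obtain ⟨q, rfl⟩ := hsurj y
    obtain ⟨σ, hσ⟩ := exists_rightInverse_mfderiv hπ q
    refine (hσ v).symm.trans (hker q (σ v) fun w => ?_)
    rw [← h]
    refine (pullback_apply_two π τ q (σ v) w).trans ?_
    rw [hσ v]
    exact hv _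
  -- near every point, `τ` is a pullback of `Ω`
  have hloc : ∀ y, ∃ (g : N → M) (V : Set N), IsOpen V ∧ y ∈ V ∧
      (∀ z ∈ V, ContMDiffAt 𝓘(ℝ, EN) 𝓘(ℝ, E) ∞ g z) ∧
      ∀ z ∈ V, τ z = pullback (E := EN) g Ω z := by
    intro y
    obtain ⟨q, rfl⟩ := hsurj y
    obtain ⟨s, V, hV, hqV, -, hs⟩ := exists_localSection hπ q
    refine ⟨f ∘ s, V, hV, hqV, fun z hz => hf.contMDiffAt.comp z (hs z hz).1, fun z hz => ?_⟩
    have hsz : MDifferentiableAt 𝓘(ℝ, EN) 𝓘(ℝ, EQ) s z := (hs z hz).1.mdifferentiableAt (by simp)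
    have e : π ∘ s =ᶠ[𝓝 z] id := by
      filter_upwards [hV.mem_nhds hz] with w hw using (hs w hw).2
    have h1 := pullback_comp Ω (hf.contMDiffAt.mdifferentiableAt (by simp)) hsz
    rw [← h] at h1
    have h2 := pullback_comp τ (hπ.contMDiff.contMDiffAt.mdifferentiableAt (by simp)) hsz
    exact ((pullback_id τ z).symm.trans (pullback_congr τ e.symm)).trans (h2.trans h1.symm)
  refine ⟨smoothFormOn_of_locally fun y => ?_, hnondeg, fun y => ?_⟩
  · obtain ⟨g, V, hV, hyV, hg, hτ⟩ := hloc y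
    exact ⟨V, hyV, hV, smoothFormOn_of_pullback isOpen_univ hΩ.smooth fun z hz =>
      ⟨trivial, hg z hz, Filter.eventually_of_mem (hV.mem_nhds hz) hτ⟩⟩
  · obtain ⟨g, V, hV, hyV, hg, hτ⟩ := hloc y
    obtain ⟨U, hU, hyU, ρ, hρ, hρpos, hsymp⟩ := hΩ.locally_conformal (g y)
    have hgc : ContinuousOn g V := fun z hz => (hg z hz).continuousAt.continuousWithinAt
    have hW := hgc.isOpen_inter_preimage hV hU
    have hτ' : ∀ z ∈ V ∩ g ⁻¹' U, ∀ᶠ w in 𝓝 z,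
        smulForm (ρ ∘ g) τ w = pullback (E := EN) g (smulForm ρ Ω) w := by
      intro z hz
      filter_upwards [hV.mem_nhds hz.1] with w hw
      rw [pullback_smulForm]
      simp only [smulForm]
      rw [hτ w hw]
    refine ⟨V ∩ g ⁻¹' U, hW, ⟨hyV, hyU⟩, ρ ∘ g, fun z hz => ?_,
      fun z hz => hρpos _ hz.2, ?_, ?_, ?_⟩
    · exact ((hρ.contMDiffAt (hU.mem_nhds hz.2)).comp z (hg z hz.1)).contMDiffWithinAt
    · exact smoothFormOn_of_pullback hU hsymp.smooth fun z hz => ⟨hz.2, hg z hz.1, hτ' z hz⟩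
    · intro z hz v hv
      refine hnondeg z v fun w => ?_
      exact (mul_eq_zero.1 (hv w)).resolve_left (hρpos _ hz.2).ne'
    · intro z hz
      rw [extD_congr (hτ' z hz), extD_pullback hU hsymp.smooth hz.2 (hg z hz.1)]
      simp only [pullback]
      rw [hsymp.closed _ hz.2]
      rfl

end Base

end LCSReduction

open LCSReduction in
theorem mainTheorem2
    {EM EQ EN : Type*}
    [NormedAddCommGroup EM] [NormedSpace ℝ EM] [FiniteDimensional ℝ EM]
    [NormedAddCommGroup EQ] [NormedSpace ℝ EQ] [FiniteDimensional ℝ EQ]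
    [NormedAddCommGroup EN] [NormedSpace ℝ EN] [FiniteDimensional ℝ EN]
    {M Q N : Type*}
    [TopologicalSpace M] [ChartedSpace EM M] [IsManifold 𝓘(ℝ, EM) ∞ M]
    [T2Space M] [SecondCountableTopology M]
    [TopologicalSpace Q] [ChartedSpace EQ Q] [IsManifold 𝓘(ℝ, EQ) ∞ Q]
    [T2Space Q] [SecondCountableTopology Q]
    [TopologicalSpace N] [ChartedSpace EN N] [IsManifold 𝓘(ℝ, EN) ∞ N]
    [T2Space N] [SecondCountableTopology N]
    (n : ℕ) (hn : 2 < 2 * n) (hdimM : Module.finrank ℝ EM = 2 * n)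
    (Ω : DiffForm EM M 2) (η : DiffForm EM M 1) (hM : IsLCSManifold Ω η)
    (ι : Q → M) (hι : Manifold.IsImmersion 𝓘(ℝ, EQ) 𝓘(ℝ, EM) ∞ ι)
    (hι_inj : Function.Injective ι)
    (r : ℕ) (hrank : ∀ q : Q,
      Module.finrank ℝ (charDistribution (EQ := EQ) Ω ι q) = r)
    (π : Q → N) (hleaf : IsLeafSpaceProjection (E := EQ) (charDistribution Ω ι) π)
    (hdimN : 2 < Module.finrank ℝ EN)
    (hπ : Manifold.IsSubmersion 𝓘(ℝ, EQ) 𝓘(ℝ, EN) ∞ π) :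
    (∃ τ : DiffForm EN N 2, IsLCSForm τ ∧
        pullback (E := EQ) π τ = pullback (E := EQ) ι Ω) ↔
      ∀ X : ∀ q : Q, TangentSpace 𝓘(ℝ, EQ) q,
        ContMDiff 𝓘(ℝ, EQ) 𝓘(ℝ, EQ).tangent ∞
          (fun q => (⟨q, X q⟩ : TangentBundle 𝓘(ℝ, EQ) Q)) →
        (∀ q, X q ∈ charDistribution (EQ := EQ) Ω ι q) →
        ∀ q, pullback (E := EQ) ι η q ![X q] = 0 := by
  constructor
  · rintro ⟨τ, hτ, h⟩ X - hX q
    have : Nontrivial EN := Module.nontrivial_of_finrank_pos (R := ℝ) (by omega)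
    exact lee_eq_zero_of_pullback_eq hM hι.contMDiff hπ hτ h
      ((mem_charDistribution Ω ι q (X q)).1 (hX q))
  · intro hη
    have hD : ∀ (q : Q) (v : EQ), mfderiv 𝓘(ℝ, EQ) 𝓘(ℝ, EN) π q v = 0 ↔
        ∀ w : EQ, pullback (E := EQ) ι Ω q ![v, w] = 0 := by
      intro q v
      have h1 : v ∈ charDistribution (EQ := EQ) Ω ι q ↔ mfderiv 𝓘(ℝ, EQ) 𝓘(ℝ, EN) π q v = 0 := by
        rw [hleaf.eq_ker hπ q]
        rfl
      exact h1.symm.trans (mem_charDistribution Ω ι q v)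
    have hηv : ∀ (q : Q) (v : EQ), mfderiv 𝓘(ℝ, EQ) 𝓘(ℝ, EN) π q v = 0 →
        pullback (E := EQ) ι η q ![v] = 0 := by
      intro q v hv
      obtain ⟨X, hX, hXπ, rfl⟩ := exists_vertical_section hπ q v hv
      exact hη X hX (fun p => (mem_charDistribution Ω ι p (X p)).2 ((hD p (X p)).1 (hXπ p))) q
    obtain ⟨τ, hτ⟩ := exists_pullback_eq hπ hleaf.surjective hleaf.isPreconnected_fibre
      (hM.isLCSForm.smooth.pullback hι.contMDiff) (fun q v hv => (hD q v).1 hv)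
      (fun q v hv a b => by
        rw [extD_pullback_apply_of_lee hM.isLCSForm.smooth hM.lee_eq hι.contMDiff ((hD q v).1 hv),
          hηv q v hv, zero_mul])
    exact ⟨τ, isLCSForm_of_pullback_eq hM.isLCSForm hι.contMDiff hπ hleaf.surjective hτ
      (fun q v hv => (hD q v).2 hv), hτ⟩
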